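/- Let $K$ be a field and $H$ a bialgebra over $K$. Let $B$ be an (associative unital) $K$-algebra that is also a coalgebra, with a right weak action of $H$ and a right $H$-comodule coalgebra structure. That is, there is a linear map $B\otimes H\to B$, $b\otimes x\mapsto b\triangleleft x$, with $b\triangleleft 1_H=b$, $1_B\triangleleft x=\varepsilon_H(x)1_B$, $(bb')\triangleleft x=(b\triangleleft x_1)(b'\triangleleft x_2)$, and a right $H$-comodule structure $b\mapsto b_{[0]}\otimes b_{[1]}\in B\otimes H$ with $b_{[0]1}\otimes b_{[0]2}\otimes b_{[1]}=b_{1[0]}\otimes b_{2[0]}\otimes b_{1[1]}b_{2[1]}$ and $\varepsilon_B(b_{[0]})b_{[1]}=\varepsilon_B(b)1_H$. Let $\tau:H\otimes H\to B$ be a linear map with $\varepsilon_B(\tau(x,x'))=\varepsilon_H(x)\varepsilon_H(x')$. Assume that the right crossed product $H\,{}^{\tau}\#B$, that is, the vector space $H\otimes B$ with the product $$(x\otimes b)(x'\otimes b')=x_1x'_1\otimes\tau(x_2,x'_2)(b\triangleleft x'_3)b',$$ is an associative algebra with unit $1_H\otimes 1_B$. Then $H\,{}^{\tau}\#B$, equipped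 with the right smash coproduct $H\times B$, that is, with $$\Delta(x\otimes b)=(x_1\otimes b_{1[0]})\otimes(x_2b_{1[1]}\otimes b_2),\qquad \varepsilon(x\otimes b)=\varepsilon_H(x)\varepsilon_B(b),$$ is a bialgebra if and only if the following conditions hold for all $x,x'\in H$ and $b,b'\in B$: 1. $\varepsilon_B$ is an algebra map; 2. $\Delta_B(1_B)=1_B\otimes 1_B$; 3. $1_{B[0]}\otimes 1_{B[1]}=1_B\otimes 1_H$; 4. $\varepsilon_B(b\triangleleft x)=\varepsilon_B(b)\varepsilon_H(x)$; 5. $b_{1[0]}\otimes xb_{1[1]}\otimes b_2=b_{1[0]}\otimes x_1b_{1[1]}\otimes\tau(x_2,b_{1[2]})b_2$; 6. $(bb')_1\otimes(bb')_2=b_{1[0]}b'_{1[0]}\otimes\tau(b_{1[1]},b'_{1[1]})(b_2\triangleleft b'_{1[2]})b'_2$; 7. $(bb')_{[0]}\otimes(bb')_{[1]}=b_{[0]}b'_{[0]}\otimes b_{[1]}b'_{[1]}$; 8. $\tau(x_2,x'_2)_{[0]}\otimes x_1x'_1\,\tau(x_2,x'_2)_{[1]}=\tau(x_1,x'_1)\otimes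 x_2x'_2$; 9. $\tau(x,x')_1\otimes\tau(x,x')_2=\tau(x_1,x'_1)\otimes\tau(x_2,x'_2)$; 10. $(b\triangleleft x_2)_{[0]}\otimes x_1(b\triangleleft x_2)_{[1]}=b_{[0]}\triangleleft x_1\otimes b_{[1]}x_2$; 11. $(b\triangleleft x)_1\otimes(b\triangleleft x)_2=b_{1[0]}\triangleleft x_1\otimes\tau(b_{1[1]},x_2)(b_2\triangleleft x_3)$. -/

import Mathlib

open scoped TensorProduct

namespace CrossedBiproduct

open TensorProduct Coalgebra

section Algebras

universe u v

variable {K : Type u} {V : Type v} [Field K] [AddCommGroup V] [Module K V]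

/-- The bilinear product `mul` makes the vector space `V` an associative algebra with unit `one`. -/
structure IsUnitalAssociative (mul : V →ₗ[K] V →ₗ[K] V) (one : V) : Prop where
  assoc : ∀ u v w, mul (mul u v) w = mul u (mul v w)
  one_left : ∀ v, mul one v = v
  right_one : ∀ v, mul v one = v

/-- The vector space `V` with product `mul`, unit `one`, coproduct `Δ` and counit `ε` is a
bialgebra over `K`: these are the structure maps of a `K`-bialgebra, read through a linear
isomorphism `e`. -/
def IsBialgebraWith (mul : V →ₗ[K] V →ₗ[K] V) (one : V) (Δ : V →ₗ[K] V ⊗[K] V)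
    (ε : V →ₗ[K] K) : Prop :=
  ∃ (A : Type v) (_ : Ring A) (_ : Bialgebra K A) (e : V ≃ₗ[K] A),
    (∀ v w, e (mul v w) = e v * e w) ∧ e one = 1 ∧
    (∀ v, comul (R := K) (e v) = TensorProduct.map e.toLinearMap e.toLinearMap (Δ v)) ∧
    (∀ v, counit (R := K) (e v) = ε v)

end Algebras

section Structures

variable {K H B : Type*} [Field K] [Ring H] [Bialgebra K H] [Ring B] [Algebra K B]

/-- A right weak action `b ◁ x = act b x` of the bialgebra `H` on the algebra `B`:
`b ◁ 1 = b`, `1 ◁ x = ε(x) 1` and `(b b') ◁ x = (b ◁ x₁)(b' ◁ x₂)`. -/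
structure IsRightWeakAction (act : B →ₗ[K] H →ₗ[K] B) : Prop where
  act_one : ∀ b, act b 1 = b
  one_act : ∀ x, act 1 x = counit (R := K) x • (1 : B)
  mul_act : ∀ b b' x, act (b * b') x =
    LinearMap.mul' K B (TensorProduct.map (act b) (act b') (comul (R := K) x))

/-- A right `H`-comodule structure `ρ(b) = b_[0] ⊗ b_[1]` on `B`. -/
structure IsRightComodule (ρ : B →ₗ[K] B ⊗[K] H) : Prop where
  coassoc : ∀ b, TensorProduct.assoc K B H H (ρ.rTensor H (ρ b)) =
    (comul (R := K) (A := H)).lTensor B (ρ b)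
  rTensor_counit : ∀ b, TensorProduct.rid K B ((counit (R := K) (A := H)).lTensor B (ρ b)) = b

/-- The coalgebra `B` with the coaction `ρ` is a right `H`-comodule coalgebra:
`b_[0]1 ⊗ b_[0]2 ⊗ b_[1] = b_1[0] ⊗ b_2[0] ⊗ b_1[1] b_2[1]` and `ε(b_[0]) b_[1] = ε(b) 1`. -/
structure IsRightComoduleCoalgebra [Coalgebra K B] (ρ : B →ₗ[K] B ⊗[K] H) : Prop
    extends IsRightComodule ρ where
  comul_coact : ∀ b, (comul (R := K) (A := B)).rTensor H (ρ b) =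
    (LinearMap.mul' K H).lTensor (B ⊗[K] B)
      (tensorTensorTensorComm K B H B H (TensorProduct.map ρ ρ (comul (R := K) b)))
  counit_coact : ∀ b, TensorProduct.lid K H ((counit (R := K) (A := B)).rTensor H (ρ b)) =
    counit (R := K) b • (1 : H)

/-- `(m ⊗ b) ⊗ b' ↦ m ⊗ b b'`. -/
noncomputable def mulLast (M : Type*) [AddCommGroup M] [Module K M] :
    (M ⊗[K] B) ⊗[K] B →ₗ[K] M ⊗[K] B :=
  (LinearMap.mul' K B).lTensor M ∘ₗ (TensorProduct.assoc K M B B).toLinearMap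

theorem mulLast_tmul (M : Type*) [AddCommGroup M] [Module K M] (m : M) (b b' : B) :
    mulLast (K := K) M ((m ⊗ₜ b) ⊗ₜ b') = m ⊗ₜ (b * b') := rfl

/-- `((p ⊗ h) ⊗ b) ⊗ (((p' ⊗ h') ⊗ h'') ⊗ b') ↦ p p' ⊗ τ(h, h') (b ◁ h'') b'`, where `P` is an
algebra; see `twist_tmul`. -/
noncomputable def twist (P : Type*) [Ring P] [Algebra K P] (act : B →ₗ[K] H →ₗ[K] B)
    (τ : H →ₗ[K] H →ₗ[K] B) :
    ((P ⊗[K] H) ⊗[K] B) ⊗[K] (((P ⊗[K] H) ⊗[K] H) ⊗[K] B) →ₗ[K] P ⊗[K] B :=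
  mulLast P ∘ₗ
    (mulLast P ∘ₗ
      TensorProduct.map
        (TensorProduct.map (LinearMap.mul' K P) (TensorProduct.lift τ) ∘ₗ
          (tensorTensorTensorComm K P H P H).toLinearMap)
        (TensorProduct.lift act) ∘ₗ
      (tensorTensorTensorComm K (P ⊗[K] H) B (P ⊗[K] H) H).toLinearMap).rTensor B ∘ₗ
    (TensorProduct.assoc K ((P ⊗[K] H) ⊗[K] B) ((P ⊗[K] H) ⊗[K] H) B).symm.toLinearMap

theorem twist_tmul (P : Type*) [Ring P] [Algebra K P] (act : B →ₗ[K] H →ₗ[K] B)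
    (τ : H →ₗ[K] H →ₗ[K] B) (p p' : P) (h h' h'' : H) (b b' : B) :
    twist P act τ (((p ⊗ₜ h) ⊗ₜ b) ⊗ₜ (((p' ⊗ₜ h') ⊗ₜ h'') ⊗ₜ b')) =
      (p * p') ⊗ₜ (τ h h' * act b h'' * b') := rfl

/-- The iterated coproduct `x ↦ (x₁ ⊗ x₂) ⊗ x₃`. -/
noncomputable def comul₃ : H →ₗ[K] (H ⊗[K] H) ⊗[K] H :=
  (comul (R := K) (A := H)).rTensor H ∘ₗ comul

/-- The product of the right crossed product on `H ⊗ B`,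
`(x ⊗ b)(x' ⊗ b') = x₁ x'₁ ⊗ τ(x₂, x'₂) (b ◁ x'₃) b'`. -/
noncomputable def crossedMul (act : B →ₗ[K] H →ₗ[K] B) (τ : H →ₗ[K] H →ₗ[K] B) :
    (H ⊗[K] B) →ₗ[K] (H ⊗[K] B) →ₗ[K] H ⊗[K] B :=
  (TensorProduct.mk K _ _).compr₂ (twist H act τ) |>.compl₁₂
    ((comul (R := K) (A := H)).rTensor B) ((comul₃ (K := K) (H := H)).rTensor B)

theorem crossedMul_tmul (act : B →ₗ[K] H →ₗ[K] B) (τ : H →ₗ[K] H →ₗ[K] B)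
    (x x' : H) (b b' : B) :
    crossedMul act τ (x ⊗ₜ b) (x' ⊗ₜ b') =
      twist H act τ ((comul (R := K) x ⊗ₜ b) ⊗ₜ (comul₃ (K := K) x' ⊗ₜ b')) := rfl

variable [Coalgebra K B]

/-- `b ↦ (b_1[0] ⊗ b_1[1]) ⊗ b_2`. -/
noncomputable def coactFst (ρ : B →ₗ[K] B ⊗[K] H) : B →ₗ[K] (B ⊗[K] H) ⊗[K] B :=
  ρ.rTensor B ∘ₗ comul

/-- `b ↦ ((b_1[0] ⊗ b_1[1]) ⊗ b_1[2]) ⊗ b_2`. -/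
noncomputable def coactFst₂ (ρ : B →ₗ[K] B ⊗[K] H) : B →ₗ[K] ((B ⊗[K] H) ⊗[K] H) ⊗[K] B :=
  (ρ.rTensor H ∘ₗ ρ).rTensor B ∘ₗ comul

/-- `(x₁ ⊗ x₂) ⊗ ((b₀ ⊗ h) ⊗ b₂) ↦ (x₁ ⊗ b₀) ⊗ (x₂ h ⊗ b₂)`; see `smashShape_tmul`. -/
noncomputable def smashShape :
    (H ⊗[K] H) ⊗[K] ((B ⊗[K] H) ⊗[K] B) →ₗ[K] (H ⊗[K] B) ⊗[K] (H ⊗[K] B) :=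
  (TensorProduct.assoc K (H ⊗[K] B) H B).toLinearMap ∘ₗ
    ((LinearMap.mul' K H).lTensor (H ⊗[K] B) ∘ₗ
      (tensorTensorTensorComm K H H B H).toLinearMap).rTensor B ∘ₗ
    (TensorProduct.assoc K (H ⊗[K] H) (B ⊗[K] H) B).symm.toLinearMap

/-- The coproduct of the right smash coproduct on `H ⊗ B`,
`Δ(x ⊗ b) = (x₁ ⊗ b_1[0]) ⊗ (x₂ b_1[1] ⊗ b_2)`. -/
noncomputable def smashComul (ρ : B →ₗ[K] B ⊗[K] H) :
    H ⊗[K] B →ₗ[K] (H ⊗[K] B) ⊗[K] (H ⊗[K] B) :=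
  smashShape ∘ₗ TensorProduct.map (comul (R := K) (A := H)) (coactFst ρ)

/-- The counit of the right smash coproduct on `H ⊗ B`, `ε(x ⊗ b) = ε(x) ε(b)`. -/
noncomputable def smashCounit : H ⊗[K] B →ₗ[K] K :=
  LinearMap.mul' K K ∘ₗ TensorProduct.map (counit (R := K) (A := H)) (counit (R := K) (A := B))

/-- `h ↦ x₁ h₁ ⊗ τ(x₂, h₂)`, for a fixed `x`. -/
noncomputable def mulCocycle (τ : H →ₗ[K] H →ₗ[K] B) (x : H) : H →ₗ[K] H ⊗[K] B :=
  TensorProduct.map (LinearMap.mul' K H) (TensorProduct.lift τ) ∘ₗ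
    (tensorTensorTensorComm K H H H H).toLinearMap ∘ₗ
    TensorProduct.mk K (H ⊗[K] H) (H ⊗[K] H) (comul (R := K) x) ∘ₗ comul

/-- `((b₀ ⊗ h) ⊗ b₂) ⊗ ((x₁ ⊗ x₂) ⊗ x₃) ↦ (b₀ ◁ x₁) ⊗ τ(h, x₂) (b₂ ◁ x₃)`; see
`actShape_tmul`. -/
noncomputable def actShape (act : B →ₗ[K] H →ₗ[K] B) (τ : H →ₗ[K] H →ₗ[K] B) :
    ((B ⊗[K] H) ⊗[K] B) ⊗[K] ((H ⊗[K] H) ⊗[K] H) →ₗ[K] B ⊗[K] B :=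
  mulLast B ∘ₗ
    TensorProduct.map
      (TensorProduct.map (TensorProduct.lift act) (TensorProduct.lift τ) ∘ₗ
        (tensorTensorTensorComm K B H H H).toLinearMap)
      (TensorProduct.lift act) ∘ₗ
    (tensorTensorTensorComm K (B ⊗[K] H) B (H ⊗[K] H) H).toLinearMap

/-- The coproduct of two elements of `H`, `(x₁ ⊗ x'₁) ⊗ (x₂ ⊗ x'₂)`. -/
noncomputable def comulPair (x x' : H) : (H ⊗[K] H) ⊗[K] (H ⊗[K] H) :=
  tensorTensorTensorComm K H H H H (comul (R := K) x ⊗ₜ[K] comul (R := K) x')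

/-- The compatibility conditions between the right weak action `b ◁ x = act b x`, the map `τ`, the
right coaction `ρ(b) = b_[0] ⊗ b_[1]` and the algebra and coalgebra structures of `B`. -/
structure Compatible (act : B →ₗ[K] H →ₗ[K] B) (τ : H →ₗ[K] H →ₗ[K] B)
    (ρ : B →ₗ[K] B ⊗[K] H) : Prop where
  /-- `ε_B(b b') = ε_B(b) ε_B(b')` -/
  counit_mul : ∀ b b' : B, counit (R := K) (b * b') = counit (R := K) b * counit (R := K) b'
  /-- `ε_B(1) = 1` -/
  counit_one : counit (R := K) (1 : B) = 1
  /-- `Δ_B(1) = 1 ⊗ 1` -/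
  comul_one : comul (R := K) (1 : B) = 1 ⊗ₜ[K] 1
  /-- `1_[0] ⊗ 1_[1] = 1_B ⊗ 1_H` -/
  coact_one : ρ 1 = 1 ⊗ₜ[K] 1
  /-- `ε_B(b ◁ x) = ε_B(b) ε_H(x)` -/
  counit_act : ∀ b x, counit (R := K) (act b x) = counit (R := K) b * counit (R := K) x
  /-- `b_1[0] ⊗ x b_1[1] ⊗ b_2 = b_1[0] ⊗ x₁ b_1[1] ⊗ τ(x₂, b_1[2]) b_2` -/
  twisted_cocycle : ∀ (b : B) (x : H),
    ((LinearMap.mulLeft K x).lTensor B).rTensor B (coactFst ρ b) =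
      mulLast (B ⊗[K] H)
        (((TensorProduct.assoc K B H B).symm.toLinearMap ∘ₗ
          (mulCocycle τ x).lTensor B).rTensor B (coactFst ρ b))
  /-- `(b b')_1 ⊗ (b b')_2 = b_1[0] b'_1[0] ⊗ τ(b_1[1], b'_1[1]) (b_2 ◁ b'_1[2]) b'_2` -/
  comul_mul : ∀ b b' : B,
    comul (R := K) (b * b') = twist B act τ (coactFst ρ b ⊗ₜ coactFst₂ ρ b')
  /-- `(b b')_[0] ⊗ (b b')_[1] = b_[0] b'_[0] ⊗ b_[1] b'_[1]` -/
  coact_mul : ∀ b b' : B, ρ (b * b') = ρ b * ρ b'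
  /-- `τ(x₂, x'₂)_[0] ⊗ x₁ x'₁ τ(x₂, x'₂)_[1] = τ(x₁, x'₁) ⊗ x₂ x'₂` -/
  coact_cocycle : ∀ x x' : H,
    LinearMap.mul' K (B ⊗[K] H)
        (TensorProduct.map (TensorProduct.mk K B H 1 ∘ₗ LinearMap.mul' K H)
          (ρ ∘ₗ TensorProduct.lift τ) (comulPair x x')) =
      TensorProduct.map (TensorProduct.lift τ) (LinearMap.mul' K H) (comulPair x x')
  /-- `τ(x, x')_1 ⊗ τ(x, x')_2 = τ(x₁, x'₁) ⊗ τ(x₂, x'₂)` -/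
  comul_cocycle : ∀ x x' : H, comul (R := K) (τ x x') =
    TensorProduct.map (TensorProduct.lift τ) (TensorProduct.lift τ) (comulPair x x')
  /-- `(b ◁ x₂)_[0] ⊗ x₁ (b ◁ x₂)_[1] = (b_[0] ◁ x₁) ⊗ b_[1] x₂` -/
  coact_act : ∀ (b : B) (x : H),
    LinearMap.mul' K (B ⊗[K] H)
        (TensorProduct.map (TensorProduct.mk K B H 1) (ρ ∘ₗ act b) (comul (R := K) x)) =
      TensorProduct.map (TensorProduct.lift act) (LinearMap.mul' K H)
        (tensorTensorTensorComm K B H H H (ρ b ⊗ₜ comul (R := K) x))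
  /-- `(b ◁ x)_1 ⊗ (b ◁ x)_2 = (b_1[0] ◁ x₁) ⊗ τ(b_1[1], x₂) (b_2 ◁ x₃)` -/
  comul_act : ∀ (b : B) (x : H),
    comul (R := K) (act b x) = actShape act τ (coactFst ρ b ⊗ₜ comul₃ (K := K) x)

end Structures

section Formulas

variable {K H B : Type*} [Field K] [Ring H] [Bialgebra K H] [Ring B] [Algebra K B]

theorem smashShape_tmul (x₁ x₂ h : H) (b₀ b₂ : B) :
    smashShape (K := K) ((x₁ ⊗ₜ x₂) ⊗ₜ ((b₀ ⊗ₜ h) ⊗ₜ b₂)) =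
      (x₁ ⊗ₜ b₀) ⊗ₜ ((x₂ * h) ⊗ₜ b₂) := rfl

theorem actShape_tmul (act : B →ₗ[K] H →ₗ[K] B) (τ : H →ₗ[K] H →ₗ[K] B) (h x₁ x₂ x₃ : H)
    (b₀ b₂ : B) :
    actShape act τ (((b₀ ⊗ₜ h) ⊗ₜ b₂) ⊗ₜ ((x₁ ⊗ₜ x₂) ⊗ₜ x₃)) =
      act b₀ x₁ ⊗ₜ (τ h x₂ * act b₂ x₃) := rfl

end Formulas

end CrossedBiproduct

/-! Every element factors as x ⊗ b = (x ⊗ 1)(1 ⊗ b) in the crossed product, so H ⊗ 1 and 1 ⊗ B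
generate it. The smash coproduct is coassociative and counital for any comodule coalgebra
(`smashComul_coassoc`, `rTensor_smashCounit`, `lTensor_smashCounit`). The theorem is therefore about
multiplicativity of Δ and ε, and for Δ it concentrates on the four kinds of products of generators.

Necessity. Apply ε_H or ε_B to the legs of Δ(vw) = Δ(v)Δ(w). The map `projRight` = ε_H ⊗ id commutes
with the coproducts, while `projRight` ⊗ `projLeft` recovers the coaction from Δ. The products (1 ⊗
b)(1 ⊗ b') give `comul_mul` and `coact_mul`, the products (x ⊗ 1)(x' ⊗ 1) give `comul_cocycle` and
`coact_cocycle`, and the products (1 ⊗ b)(x ⊗ 1) give `comul_act` and `coact_act`. For (x ⊗ 1)(1 ⊗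
b), multiplicativity is equivalent to `twisted_cocycle` (`smashComul_tmul_eq_tensorMul_iff`).

Sufficiency. Each pair of conditions gives back its case: `smashComul_right_right`,
`smashComul_left_left`, `smashComul_right_left`. Associativity of the crossed product then spreads
multiplicativity from generators to all elements (`smashComul_crossedMul`).

For the Sweedler computations the four slots H, B, H, B are embedded as subalgebras of the ordinary
tensor product algebra (H ⊗ B) ⊗ (H ⊗ B), where distinct slots commute. An expression becomes a
product of slot maps along coproducts and coactions (`prodAlong`), and coassociativity becomes
associativity of such products. There `*` is the ordinary product; the crossed product is always
written `crossedMul`. -/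

namespace CrossedBiproduct

open TensorProduct Coalgebra

/-! ### Bialgebra structures on a vector space in terms of their structure maps. -/

section Transport

universe u v

variable {K : Type u} {V : Type v} [Field K] [AddCommGroup V] [Module K V]

/-- The componentwise product `(a ⊗ b)(c ⊗ d) = a c ⊗ b d` on `V ⊗ V`. -/
noncomputable def tensorMul (mul : V →ₗ[K] V →ₗ[K] V) :
    (V ⊗[K] V) →ₗ[K] (V ⊗[K] V) →ₗ[K] V ⊗[K] V :=
  (TensorProduct.mk K _ _).compr₂
    (TensorProduct.map (TensorProduct.lift mul) (TensorProduct.lift mul) ∘ₗ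
      (tensorTensorTensorComm K V V V V).toLinearMap)

theorem tensorMul_tmul (mul : V →ₗ[K] V →ₗ[K] V) (a b c d : V) :
    tensorMul mul (a ⊗ₜ b) (c ⊗ₜ d) = mul a c ⊗ₜ mul b d := rfl

variable {mul : V →ₗ[K] V →ₗ[K] V} {one : V} {Δ : V →ₗ[K] V ⊗[K] V} {ε : V →ₗ[K] K}

theorem tensorMul_assoc (h : IsUnitalAssociative mul one) (r s t : V ⊗[K] V) :
    tensorMul mul (tensorMul mul r s) t = tensorMul mul r (tensorMul mul s t) := by
  induction r with
  | zero => simp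
  | add r₁ r₂ h₁ h₂ => simp [h₁, h₂]
  | tmul a b =>
    induction s with
    | zero => simp
    | add r₁ r₂ h₁ h₂ => simp only [map_add, LinearMap.add_apply, h₁, h₂]
    | tmul c d =>
      induction t with
      | zero => simp
      | add r₁ r₂ h₁ h₂ => simp only [map_add, h₁, h₂]
      | tmul e f => simp only [tensorMul_tmul, h.assoc]

theorem map_tensorMul {A : Type*} [Ring A] [Algebra K A] (e : V →ₗ[K] A)
    (he : ∀ v w, e (mul v w) = e v * e w) (s t : V ⊗[K] V) :
    TensorProduct.map e e (tensorMul mul s t) =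
      TensorProduct.map e e s * TensorProduct.map e e t := by
  induction s with
  | zero => simp
  | add r₁ r₂ h₁ h₂ => simp only [map_add, LinearMap.add_apply, h₁, h₂, add_mul]
  | tmul a b =>
    induction t with
    | zero => simp
    | add r₁ r₂ h₁ h₂ => simp only [map_add, h₁, h₂, mul_add]
    | tmul c d =>
      simp only [tensorMul_tmul, map_tmul, he, Algebra.TensorProduct.tmul_mul_tmul]

/-- The structure maps of a bialgebra: the coproduct and the counit are multiplicative and
unital. -/
theorem IsBialgebraWith.multiplicative (h : IsBialgebraWith mul one Δ ε) :
    (∀ v w, Δ (mul v w) = tensorMul mul (Δ v) (Δ w)) ∧ Δ one = one ⊗ₜ one ∧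
      (∀ v w, ε (mul v w) = ε v * ε w) ∧ ε one = 1 := by
  obtain ⟨A, _, _, e, hmul, hone, hΔ, hε⟩ := h
  have inj : Function.Injective (TensorProduct.map e.toLinearMap e.toLinearMap) :=
    (TensorProduct.congr e e).injective
  refine ⟨fun v w => inj ?_, inj ?_, fun v w => ?_, ?_⟩
  · rw [map_tensorMul e.toLinearMap hmul, ← hΔ, ← hΔ, ← hΔ, hmul, Bialgebra.comul_mul]
  · rw [← hΔ, hone, Bialgebra.comul_one]
    simp [hone, Algebra.TensorProduct.one_def]
  · rw [← hε, hmul, Bialgebra.counit_mul, hε, hε]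
  · rw [← hε, hone, Bialgebra.counit_one]

/-- The space V itself serves as the bialgebra, with the identity as the isomorphism. -/
theorem isBialgebraWith_of (h : IsUnitalAssociative mul one)
    (coassoc : TensorProduct.assoc K V V V ∘ₗ Δ.rTensor V ∘ₗ Δ = Δ.lTensor V ∘ₗ Δ)
    (rTensor_counit : ε.rTensor V ∘ₗ Δ = TensorProduct.mk K _ _ 1)
    (lTensor_counit : ε.lTensor V ∘ₗ Δ = (TensorProduct.mk K _ _).flip 1)
    (hΔ : ∀ v w, Δ (mul v w) = tensorMul mul (Δ v) (Δ w)) (hΔ₁ : Δ one = one ⊗ₜ one)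
    (hε : ∀ v w, ε (mul v w) = ε v * ε w) (hε₁ : ε one = 1) :
    IsBialgebraWith mul one Δ ε := by
  let ring : Ring V :=
    { (inferInstance : AddCommGroup V) with
      mul := fun v w => mul v w
      one := one
      mul_assoc := h.assoc
      one_mul := h.one_left
      mul_one := h.right_one
      left_distrib := fun a b c => map_add (mul a) b c
      right_distrib := fun a b c => LinearMap.map_add₂ mul a b c
      zero_mul := fun a => LinearMap.map_zero₂ mul a
      mul_zero := fun a => map_zero (mul a) }
  let algebra : Algebra K V := Algebra.ofModule
    (fun r x y => LinearMap.map_smul₂ mul r x y) (fun r x y => map_smul (mul x) r y)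
  let coalgebra : Coalgebra K V :=
    { comul := Δ
      counit := ε
      coassoc := coassoc
      rTensor_counit_comp_comul := rTensor_counit
      lTensor_counit_comp_comul := lTensor_counit }
  -- The identity of V is multiplicative for the new ring structure, so `map_tensorMul` identifies
  -- the library product on V ⊗ V with `tensorMul`.
  have key : ∀ s t : V ⊗[K] V, s * t = tensorMul mul s t := fun s t => by
    have := map_tensorMul (mul := mul) (LinearMap.id : V →ₗ[K] V) (fun _ _ => rfl) s t
    simpa using this.symm
  refine ⟨V, ring, Bialgebra.mk' K V hε₁ (hε _ _) hΔ₁ ?_, LinearEquiv.refl K V,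
    fun _ _ => rfl, rfl, fun v => ?_, fun _ => rfl⟩
  · intro v w
    exact (hΔ v w).trans (key _ _).symm
  · exact (DFunLike.congr_fun TensorProduct.map_id (Δ v)).symm

end Transport

/-! ### Products of linear maps along a decomposition. -/

section ProdAlong

variable {K L M N C D : Type*} [Field K]
  [AddCommGroup L] [Module K L] [AddCommGroup M] [Module K M] [AddCommGroup N] [Module K N]
  [Ring C] [Algebra K C] [Ring D] [Algebra K D]

/-- The product of `f` and `g` along `δ`: the linear map `l ↦ f(l₁) g(l₂)`, where
`δ(l) = l₁ ⊗ l₂`. -/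
noncomputable def prodAlong (δ : L →ₗ[K] M ⊗[K] N) (f : M →ₗ[K] C) (g : N →ₗ[K] C) : L →ₗ[K] C :=
  LinearMap.mul' K C ∘ₗ TensorProduct.map f g ∘ₗ δ

theorem prodAlong_apply (δ : L →ₗ[K] M ⊗[K] N) (f : M →ₗ[K] C) (g : N →ₗ[K] C) (l : L) :
    prodAlong δ f g l = LinearMap.mul' K C (TensorProduct.map f g (δ l)) := rfl

theorem algHom_comp_prodAlong (φ : C →ₐ[K] D) (δ : L →ₗ[K] M ⊗[K] N) (f : M →ₗ[K] C)
    (g : N →ₗ[K] C) :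
    φ.toLinearMap ∘ₗ prodAlong δ f g = prodAlong δ (φ.toLinearMap ∘ₗ f) (φ.toLinearMap ∘ₗ g) := by
  ext l
  simp only [LinearMap.comp_apply, prodAlong_apply]
  induction δ l with
  | zero => simp
  | add r₁ r₂ h₁ h₂ => simp only [map_add, h₁, h₂]
  | tmul a b => simp

theorem mulLeft_comp_prodAlong (c : C) (δ : L →ₗ[K] M ⊗[K] N) (f : M →ₗ[K] C)
    (g : N →ₗ[K] C) :
    LinearMap.mulLeft K c ∘ₗ prodAlong δ f g = prodAlong δ (LinearMap.mulLeft K c ∘ₗ f) g := by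
  ext l
  simp only [LinearMap.comp_apply, prodAlong_apply]
  induction δ l with
  | zero => simp
  | add r₁ r₂ h₁ h₂ => simp only [map_add, h₁, h₂]
  | tmul a b => simp [mul_assoc]

/-- `(f(l₁₁) g(l₁₂)) h(l₂) = f(l₁) (g(l₂₁) h(l₂₂))`, for any pair of coassociative
decompositions. -/
theorem prodAlong_assoc {P Q R : Type*} [AddCommGroup P] [Module K P] [AddCommGroup Q] [Module K Q]
    [AddCommGroup R] [Module K R]
    (δ₁ : L →ₗ[K] M ⊗[K] N) (δ₂ : M →ₗ[K] P ⊗[K] Q) (δ₃ : L →ₗ[K] P ⊗[K] R)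
    (δ₄ : R →ₗ[K] Q ⊗[K] N)
    (h : ∀ l, TensorProduct.assoc K P Q N (δ₂.rTensor N (δ₁ l)) = δ₄.lTensor P (δ₃ l))
    (f : P →ₗ[K] C) (g : Q →ₗ[K] C) (k : N →ₗ[K] C) :
    prodAlong δ₁ (prodAlong δ₂ f g) k = prodAlong δ₃ f (prodAlong δ₄ g k) := by
  ext l
  -- Both bracketings are evaluations of one triple product on P ⊗ (Q ⊗ N), so the hypothesis on the
  -- decompositions decides the equality.
  have h₁ : ∀ t : M ⊗[K] N, LinearMap.mul' K C (TensorProduct.map (prodAlong δ₂ f g) k t) =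
      LinearMap.mul' K C (TensorProduct.map f (LinearMap.mul' K C ∘ₗ TensorProduct.map g k)
        (TensorProduct.assoc K P Q N (δ₂.rTensor N t))) := by
    intro t
    induction t with
    | zero => simp
    | add r₁ r₂ h₁ h₂ => simp only [map_add, h₁, h₂]
    | tmul a b =>
      simp only [map_tmul, LinearMap.mul'_apply, prodAlong_apply, LinearMap.rTensor_tmul]
      induction δ₂ a with
      | zero => simp
      | add r₁ r₂ h₁ h₂ => simp only [map_add, add_tmul, add_mul, h₁, h₂]
      | tmul c d => simp [mul_assoc]
  have h₂ : ∀ t : P ⊗[K] R, LinearMap.mul' K C (TensorProduct.map f (prodAlong δ₄ g k) t) =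
      LinearMap.mul' K C (TensorProduct.map f (LinearMap.mul' K C ∘ₗ TensorProduct.map g k)
        (δ₄.lTensor P t)) := by
    intro t
    induction t with
    | zero => simp
    | add r₁ r₂ h₁ h₂ => simp only [map_add, h₁, h₂]
    | tmul a b => simp [prodAlong_apply]
  rw [prodAlong_apply, h₁, h, ← h₂, prodAlong_apply]

theorem prodAlong_comul_assoc {L : Type*} [AddCommGroup L] [Module K L] [Coalgebra K L]
    (f g k : L →ₗ[K] C) :
    prodAlong comul (prodAlong comul f g) k = prodAlong comul f (prodAlong comul g k) :=
  prodAlong_assoc _ _ _ _ (fun l => coassoc_apply l) f g k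

end ProdAlong

/-! ### The four tensor slots as commuting subalgebras. -/

section Inclusions

variable {K H B : Type*} [Field K] [Ring H] [Bialgebra K H] [Ring B] [Algebra K B]
variable {C : Type*} [Ring C] [Algebra K C]

theorem prodAlong_coact_assoc {ρ : B →ₗ[K] B ⊗[K] H} (hρ : IsRightComodule ρ) (f : B →ₗ[K] C)
    (g k : H →ₗ[K] C) :
    prodAlong ρ (prodAlong ρ f g) k = prodAlong ρ f (prodAlong comul g k) :=
  prodAlong_assoc _ _ _ _ hρ.coassoc f g k

variable (K H B) in
/-- The inclusion of the first tensor factor of `(H ⊗ B) ⊗ (H ⊗ B)`. -/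
noncomputable def incl₁ : H →ₐ[K] (H ⊗[K] B) ⊗[K] (H ⊗[K] B) :=
  Algebra.TensorProduct.includeLeft.comp Algebra.TensorProduct.includeLeft

variable (K H B) in
/-- The inclusion of the second tensor factor of `(H ⊗ B) ⊗ (H ⊗ B)`. -/
noncomputable def incl₂ : B →ₐ[K] (H ⊗[K] B) ⊗[K] (H ⊗[K] B) :=
  Algebra.TensorProduct.includeLeft.comp Algebra.TensorProduct.includeRight

variable (K H B) in
/-- The inclusion of the third tensor factor of `(H ⊗ B) ⊗ (H ⊗ B)`. -/
noncomputable def incl₃ : H →ₐ[K] (H ⊗[K] B) ⊗[K] (H ⊗[K] B) :=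
  Algebra.TensorProduct.includeRight.comp Algebra.TensorProduct.includeLeft

variable (K H B) in
/-- The inclusion of the fourth tensor factor of `(H ⊗ B) ⊗ (H ⊗ B)`. -/
noncomputable def incl₄ : B →ₐ[K] (H ⊗[K] B) ⊗[K] (H ⊗[K] B) :=
  Algebra.TensorProduct.includeRight.comp Algebra.TensorProduct.includeRight

theorem incl₁_apply (x : H) : incl₁ K H B x = (x ⊗ₜ 1) ⊗ₜ (1 ⊗ₜ 1) := rfl
theorem incl₂_apply (b : B) : incl₂ K H B b = (1 ⊗ₜ b) ⊗ₜ (1 ⊗ₜ 1) := rfl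
theorem incl₃_apply (x : H) : incl₃ K H B x = (1 ⊗ₜ 1) ⊗ₜ (x ⊗ₜ 1) := rfl
theorem incl₄_apply (b : B) : incl₄ K H B b = (1 ⊗ₜ 1) ⊗ₜ (1 ⊗ₜ b) := rfl

variable (K H B) in
/-- `x ↦ (x₁ ⊗ 1) ⊗ (x₂ ⊗ 1)`. -/
noncomputable def comulLeft : H →ₗ[K] (H ⊗[K] B) ⊗[K] (H ⊗[K] B) :=
  prodAlong comul (incl₁ K H B).toLinearMap (incl₃ K H B).toLinearMap

/-- Δ_H is multiplicative and the first and third slots commute. -/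
theorem comulLeft_mul (x y : H) :
    comulLeft K H B (x * y) = comulLeft K H B x * comulLeft K H B y := by
  simp only [comulLeft, prodAlong_apply, Bialgebra.comul_mul]
  induction comul (R := K) x with
  | zero => simp
  | add r₁ r₂ h₁ h₂ => simp only [map_add, add_mul, h₁, h₂]
  | tmul a b =>
    induction comul (R := K) y with
    | zero => simp
    | add r₁ r₂ h₁ h₂ => simp only [map_add, mul_add, h₁, h₂]
    | tmul c d => simp [incl₁_apply, incl₃_apply, Algebra.TensorProduct.tmul_mul_tmul]

/-- This separates the H-part from the B-part. The second slot commutes with the third, where the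
two contributions meet in the order x₂ h. -/
theorem smashShape_eq_mul (t : H ⊗[K] H) (s : (B ⊗[K] H) ⊗[K] B) :
    smashShape (t ⊗ₜ s) =
      LinearMap.mul' K _ (TensorProduct.map (incl₁ K H B).toLinearMap
        (incl₃ K H B).toLinearMap t) *
      LinearMap.mul' K _ (TensorProduct.map (LinearMap.mul' K _ ∘ₗ
        TensorProduct.map (incl₂ K H B).toLinearMap (incl₃ K H B).toLinearMap)
        (incl₄ K H B).toLinearMap s) := by
  induction t with
  | zero => simp
  | add r₁ r₂ h₁ h₂ => simp only [map_add, add_tmul, add_mul, h₁, h₂]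
  | tmul x y =>
    induction s with
    | zero => simp
    | add r₁ r₂ h₁ h₂ => simp only [map_add, tmul_add, mul_add, h₁, h₂]
    | tmul u b =>
      induction u with
      | zero => simp
      | add r₁ r₂ h₁ h₂ => simp only [map_add, tmul_add, add_tmul, mul_add, h₁, h₂]
      | tmul c h =>
        simp [smashShape_tmul, incl₁_apply, incl₂_apply, incl₃_apply, incl₄_apply,
          Algebra.TensorProduct.tmul_mul_tmul]

end Inclusions

/-! ### The smash coproduct is a coalgebra. -/

section SmashCoproduct

variable {K H B : Type*} [Field K] [Ring H] [Bialgebra K H] [Ring B] [Algebra K B]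
  [Coalgebra K B]
variable {C : Type*} [Ring C] [Algebra K C]

theorem prodAlong_prodAlong_coact (ρ : B →ₗ[K] B ⊗[K] H) (f : B →ₗ[K] C) (g : H →ₗ[K] C)
    (k : B →ₗ[K] C) (b : B) :
    prodAlong comul (prodAlong ρ f g) k b =
      LinearMap.mul' K C (TensorProduct.map (LinearMap.mul' K C ∘ₗ TensorProduct.map f g) k
        (coactFst ρ b)) := by
  simp only [coactFst, LinearMap.comp_apply, prodAlong_apply]
  induction comul (R := K) b with
  | zero => simp
  | add r₁ r₂ h₁ h₂ => simp only [map_add, h₁, h₂]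
  | tmul a b => simp [prodAlong_apply]

/-- This is the comodule coalgebra axiom in product form. Since k is an algebra map, k(b_1[1]
b_2[1]) splits, and the commutation hypothesis carries k(b_1[1]) past g(b_2[0]). -/
theorem prodAlong_coact_mul {ρ : B →ₗ[K] B ⊗[K] H} (hρ : IsRightComoduleCoalgebra ρ)
    (f g : B →ₗ[K] C) (k : H →ₐ[K] C) (hgk : ∀ b x, Commute (g b) (k x)) :
    prodAlong ρ (prodAlong comul f g) k.toLinearMap =
      prodAlong comul (prodAlong ρ f k.toLinearMap) (prodAlong ρ g k.toLinearMap) := by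
  ext b
  have h₁ : ∀ t : B ⊗[K] H,
      LinearMap.mul' K C (TensorProduct.map (prodAlong comul f g) k.toLinearMap t) =
        LinearMap.mul' K C (TensorProduct.map (LinearMap.mul' K C ∘ₗ TensorProduct.map f g)
          k.toLinearMap ((comul (R := K) (A := B)).rTensor H t)) := by
    intro t
    induction t with
    | zero => simp
    | add r₁ r₂ h₁ h₂ => simp only [map_add, h₁, h₂]
    | tmul a b => simp [prodAlong_apply]
  rw [prodAlong_apply, h₁, hρ.comul_coact, prodAlong_apply]
  induction comul (R := K) b with
  | zero => simp
  | add r₁ r₂ h₁ h₂ => simp only [map_add, h₁, h₂]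
  | tmul a b =>
    simp only [map_tmul, prodAlong_apply, LinearMap.mul'_apply]
    induction ρ a with
    | zero => simp
    | add r₁ r₂ h₁ h₂ => simp only [map_add, add_tmul, add_mul, h₁, h₂]
    | tmul c x =>
      induction ρ b with
      | zero => simp
      | add r₁ r₂ h₁ h₂ => simp only [map_add, tmul_add, mul_add, h₁, h₂]
      | tmul d y =>
        simp only [tensorTensorTensorComm_tmul, LinearMap.lTensor_tmul, LinearMap.mul'_apply,
          map_tmul, LinearMap.comp_apply, AlgHom.toLinearMap_apply, map_mul]
        rw [mul_assoc, ← mul_assoc (g d), (hgk d x).eq]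
        simp only [mul_assoc]

/-- `b ↦ (1 ⊗ b_1[0]) ⊗ (b_1[1] ⊗ b_2)`. -/
noncomputable def comulRight (ρ : B →ₗ[K] B ⊗[K] H) : B →ₗ[K] (H ⊗[K] B) ⊗[K] (H ⊗[K] B) :=
  prodAlong comul (prodAlong ρ (incl₂ K H B).toLinearMap (incl₃ K H B).toLinearMap)
    (incl₄ K H B).toLinearMap

theorem smashComul_tmul (ρ : B →ₗ[K] B ⊗[K] H) (x : H) (b : B) :
    smashComul ρ (x ⊗ₜ b) = comulLeft K H B x * comulRight ρ b := by
  rw [comulRight, prodAlong_prodAlong_coact]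
  exact smashShape_eq_mul _ _

theorem smashComul_tmul' (ρ : B →ₗ[K] B ⊗[K] H) (x : H) (b : B) :
    smashComul ρ (x ⊗ₜ b) = smashShape (comul (R := K) x ⊗ₜ coactFst ρ b) := rfl

/-- The middle entry x₂ h is split by `comulLeft_mul`, so the H-part and the B-part stay separate
after a second coproduct. -/
theorem lTensor_smashComul_smashShape (ρ : B →ₗ[K] B ⊗[K] H) (t : H ⊗[K] H)
    (s : (B ⊗[K] H) ⊗[K] B) :
    (smashComul ρ).lTensor (H ⊗[K] B) (smashShape (t ⊗ₜ s)) =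
      LinearMap.mul' K _ (TensorProduct.map
        ((Algebra.TensorProduct.includeLeft (R := K) (S := K)
          (B := (H ⊗[K] B) ⊗[K] (H ⊗[K] B))).comp
          (Algebra.TensorProduct.includeLeft (R := K) (S := K) (A := H) (B := B))).toLinearMap
        ((Algebra.TensorProduct.includeRight (R := K) (A := H ⊗[K] B)).toLinearMap ∘ₗ
          comulLeft K H B) t) *
      LinearMap.mul' K _ (TensorProduct.map (LinearMap.mul' K _ ∘ₗ TensorProduct.map
        ((Algebra.TensorProduct.includeLeft (R := K) (S := K)
          (B := (H ⊗[K] B) ⊗[K] (H ⊗[K] B))).comp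
          (Algebra.TensorProduct.includeRight (R := K) (A := H) (B := B))).toLinearMap
        ((Algebra.TensorProduct.includeRight (R := K) (A := H ⊗[K] B)).toLinearMap ∘ₗ
          comulLeft K H B))
        ((Algebra.TensorProduct.includeRight (R := K) (A := H ⊗[K] B)).toLinearMap ∘ₗ
          comulRight ρ) s) := by
  induction t with
  | zero => simp
  | add r₁ r₂ h₁ h₂ => simp only [map_add, add_tmul, add_mul, h₁, h₂]
  | tmul x y =>
    induction s with
    | zero => simp
    | add r₁ r₂ h₁ h₂ => simp only [map_add, tmul_add, mul_add, h₁, h₂]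
    | tmul u b =>
      induction u with
      | zero => simp
      | add r₁ r₂ h₁ h₂ => simp only [map_add, tmul_add, add_tmul, mul_add, h₁, h₂]
      | tmul c h =>
        simp [smashShape_tmul, smashComul_tmul, comulLeft_mul, mul_assoc,
          Algebra.TensorProduct.tmul_mul_tmul]

/-- Only commutation is needed here: the contribution of x₂ lies in the last copy of H ⊗ B and
passes the coproduct of b₀, which lies in the first two. -/
theorem assoc_rTensor_smashComul_smashShape (ρ : B →ₗ[K] B ⊗[K] H) (t : H ⊗[K] H)
    (s : (B ⊗[K] H) ⊗[K] B) :
    TensorProduct.assoc K (H ⊗[K] B) (H ⊗[K] B) (H ⊗[K] B)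
      ((smashComul ρ).rTensor (H ⊗[K] B) (smashShape (t ⊗ₜ s))) =
      LinearMap.mul' K _ (TensorProduct.map
        (((Algebra.TensorProduct.assoc K K K (H ⊗[K] B) (H ⊗[K] B) (H ⊗[K] B)).toAlgHom.comp
          Algebra.TensorProduct.includeLeft).toLinearMap ∘ₗ comulLeft K H B)
        ((Algebra.TensorProduct.includeRight (R := K) (A := H ⊗[K] B)).comp
          (incl₃ K H B)).toLinearMap t) *
      LinearMap.mul' K _ (TensorProduct.map (LinearMap.mul' K _ ∘ₗ TensorProduct.map
        (((Algebra.TensorProduct.assoc K K K (H ⊗[K] B) (H ⊗[K] B) (H ⊗[K] B)).toAlgHom.comp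
          Algebra.TensorProduct.includeLeft).toLinearMap ∘ₗ comulRight ρ)
        ((Algebra.TensorProduct.includeRight (R := K) (A := H ⊗[K] B)).comp
          (incl₃ K H B)).toLinearMap)
        ((Algebra.TensorProduct.includeRight (R := K) (A := H ⊗[K] B)).comp
          (incl₄ K H B)).toLinearMap s) := by
  induction t with
  | zero => simp
  | add r₁ r₂ h₁ h₂ => simp only [map_add, add_tmul, add_mul, h₁, h₂]
  | tmul x y =>
    induction s with
    | zero => simp
    | add r₁ r₂ h₁ h₂ => simp only [map_add, tmul_add, mul_add, h₁, h₂]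
    | tmul u b =>
      induction u with
      | zero => simp
      | add r₁ r₂ h₁ h₂ => simp only [map_add, tmul_add, add_tmul, mul_add, h₁, h₂]
      | tmul c h =>
        simp only [smashShape_tmul, smashComul_tmul, LinearMap.rTensor_tmul, map_tmul,
          LinearMap.mul'_apply, LinearMap.comp_apply, AlgHom.toLinearMap_apply, AlgHom.comp_apply,
          Algebra.TensorProduct.includeLeft_apply, Algebra.TensorProduct.includeRight_apply,
          incl₃_apply, incl₄_apply]
        induction comulLeft K H B x with
        | zero => simp
        | add r₁ r₂ h₁ h₂ => simp only [map_add, add_tmul, add_mul, h₁, h₂]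
        | tmul p q =>
          induction comulRight ρ c with
          | zero => simp
          | add r₁ r₂ h₁ h₂ => simp only [map_add, add_tmul, add_mul, mul_add, h₁, h₂]
          | tmul r s =>
            simp [Algebra.TensorProduct.tmul_mul_tmul, ← Algebra.TensorProduct.one_def]

/-- The H-parts agree by coassociativity of H. For the B-parts, the comodule coalgebra axiom
distributes the outer coaction over the inner coproduct; coassociativity of the coaction and of B
finishes. -/
theorem smashComul_coassoc {ρ : B →ₗ[K] B ⊗[K] H} (hρ : IsRightComoduleCoalgebra ρ) :
    TensorProduct.assoc K (H ⊗[K] B) (H ⊗[K] B) (H ⊗[K] B) ∘ₗ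
      (smashComul ρ).rTensor (H ⊗[K] B) ∘ₗ smashComul ρ =
    (smashComul ρ).lTensor (H ⊗[K] B) ∘ₗ smashComul ρ := by
  refine TensorProduct.ext' fun x b => ?_
  refine (assoc_rTensor_smashComul_smashShape ρ _ _).trans
    (Eq.trans ?_ (lTensor_smashComul_smashShape ρ _ _).symm)
  rw [← prodAlong_prodAlong_coact, ← prodAlong_prodAlong_coact, ← prodAlong_apply,
    ← prodAlong_apply]
  congr 1
  · rw [comulLeft, algHom_comp_prodAlong, algHom_comp_prodAlong, prodAlong_comul_assoc]
    rfl
  · rw [comulRight, comulLeft, algHom_comp_prodAlong, algHom_comp_prodAlong,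
      algHom_comp_prodAlong, algHom_comp_prodAlong, algHom_comp_prodAlong, prodAlong_coact_mul hρ,
      prodAlong_coact_assoc hρ.toIsRightComodule, prodAlong_comul_assoc]
    · rfl
    · intro b x
      simp [Commute, SemiconjBy, incl₃_apply, incl₄_apply, Algebra.TensorProduct.one_def,
        Algebra.TensorProduct.tmul_mul_tmul]

theorem rTensor_counit_coactFst {ρ : B →ₗ[K] B ⊗[K] H} (hρ : IsRightComoduleCoalgebra ρ) (b : B) :
    ((TensorProduct.lid K H).toLinearMap ∘ₗ (counit (R := K) (A := B)).rTensor H).rTensor B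
      (coactFst ρ b) = 1 ⊗ₜ b := by
  have h : ∀ t : B ⊗[K] B,
      ((TensorProduct.lid K H).toLinearMap ∘ₗ (counit (R := K) (A := B)).rTensor H).rTensor B
        (ρ.rTensor B t) =
      (LinearMap.toSpanSingleton K H 1).rTensor B ((counit (R := K) (A := B)).rTensor B t) := by
    intro t
    induction t with
    | zero => simp
    | add r₁ r₂ h₁ h₂ => simp only [map_add, h₁, h₂]
    | tmul c d => simp [hρ.counit_coact]
  rw [coactFst, LinearMap.comp_apply, h]
  simp

theorem lTensor_counit_rTensor_coactFst {ρ : B →ₗ[K] B ⊗[K] H} (hρ : IsRightComodule ρ) (b : B) :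
    ((TensorProduct.rid K B).toLinearMap ∘ₗ (counit (R := K) (A := H)).lTensor B).rTensor B
      (coactFst ρ b) = comul b := by
  rw [coactFst, LinearMap.comp_apply, ← LinearMap.comp_apply, ← LinearMap.rTensor_comp]
  have : ((TensorProduct.rid K B).toLinearMap ∘ₗ (counit (R := K) (A := H)).lTensor B) ∘ₗ ρ =
      LinearMap.id := LinearMap.ext hρ.rTensor_counit
  rw [this]
  simp

theorem lTensor_counit_coactFst (ρ : B →ₗ[K] B ⊗[K] H) (b : B) :
    (counit (R := K) (A := B)).lTensor (B ⊗[K] H) (coactFst ρ b) = ρ b ⊗ₜ 1 := by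
  rw [coactFst, LinearMap.comp_apply, ← LinearMap.comp_apply, LinearMap.lTensor_comp_rTensor,
    ← LinearMap.rTensor_comp_lTensor, LinearMap.comp_apply]
  simp

theorem smashCounit_tmul (x : H) (b : B) :
    smashCounit (K := K) (x ⊗ₜ[K] b) = counit (R := K) x * counit (R := K) b := rfl

theorem rTensor_smashCounit {ρ : B →ₗ[K] B ⊗[K] H} (hρ : IsRightComoduleCoalgebra ρ) :
    (smashCounit (K := K) (H := H) (B := B)).rTensor (H ⊗[K] B) ∘ₗ smashComul ρ =
      TensorProduct.mk K _ _ 1 := by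
  refine TensorProduct.ext' fun x b => ?_
  have h : ∀ (t : H ⊗[K] H) (s : (B ⊗[K] H) ⊗[K] B),
      (smashCounit (K := K) (H := H) (B := B)).rTensor (H ⊗[K] B) (smashShape (t ⊗ₜ s)) =
        TensorProduct.mk K K _ 1 ((TensorProduct.lid K H ((counit (R := K)).rTensor H t) ⊗ₜ 1) *
          ((TensorProduct.lid K H).toLinearMap ∘ₗ (counit (R := K) (A := B)).rTensor H).rTensor B
            s) := by
    intro t s
    induction t with
    | zero => simp
    | add r₁ r₂ h₁ h₂ => simp only [map_add, add_tmul, add_mul, h₁, h₂]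
    | tmul x y =>
      induction s with
      | zero => simp
      | add r₁ r₂ h₁ h₂ => simp only [map_add, tmul_add, mul_add, h₁, h₂]
      | tmul u b =>
        induction u with
        | zero => simp
        | add r₁ r₂ h₁ h₂ => simp only [map_add, tmul_add, add_tmul, mul_add, h₁, h₂]
        | tmul c h =>
          simp only [smashShape_tmul, LinearMap.rTensor_tmul, smashCounit_tmul, lid_tmul,
            LinearMap.comp_apply, LinearEquiv.coe_coe, Algebra.TensorProduct.tmul_mul_tmul,
            one_mul, mk_apply, smul_mul_smul_comm, ← smul_tmul']
          rw [tmul_smul, smul_tmul', smul_eq_mul, mul_one]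
  rw [LinearMap.comp_apply, smashComul_tmul', h, rTensor_counit_coactFst hρ]
  simp

theorem lTensor_smashCounit {ρ : B →ₗ[K] B ⊗[K] H} (hρ : IsRightComoduleCoalgebra ρ) :
    (smashCounit (K := K) (H := H) (B := B)).lTensor (H ⊗[K] B) ∘ₗ smashComul ρ =
      (TensorProduct.mk K _ _).flip 1 := by
  refine TensorProduct.ext' fun x b => ?_
  have h : ∀ (t : H ⊗[K] H) (s : (B ⊗[K] H) ⊗[K] B),
      (smashCounit (K := K) (H := H) (B := B)).lTensor (H ⊗[K] B) (smashShape (t ⊗ₜ s)) =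
        (TensorProduct.mk K _ K).flip 1
          (TensorProduct.rid K H ((counit (R := K)).lTensor H t) ⊗ₜ
            TensorProduct.rid K B ((counit (R := K)).lTensor B
              (((TensorProduct.rid K B).toLinearMap ∘ₗ
                (counit (R := K) (A := H)).lTensor B).rTensor B s))) := by
    intro t s
    induction t with
    | zero => simp
    | add r₁ r₂ h₁ h₂ => simp only [map_add, add_tmul, h₁, h₂]
    | tmul x y =>
      induction s with
      | zero => simp
      | add r₁ r₂ h₁ h₂ => simp only [map_add, tmul_add, h₁, h₂]
      | tmul u b =>
        induction u with
        | zero => simp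
        | add r₁ r₂ h₁ h₂ => simp only [map_add, tmul_add, add_tmul, h₁, h₂]
        | tmul c h =>
          simp only [smashShape_tmul, LinearMap.lTensor_tmul, LinearMap.rTensor_tmul,
            smashCounit_tmul, rid_tmul, LinearMap.comp_apply, LinearEquiv.coe_coe,
            LinearMap.flip_apply, mk_apply, Bialgebra.counit_mul]
          simp only [tmul_smul, ← smul_tmul', smul_smul]
          rw [← mul_one (_ * _ * _), ← smul_eq_mul, tmul_smul]
          congr 1
          ring
  rw [LinearMap.comp_apply, smashComul_tmul', h, lTensor_counit_rTensor_coactFst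
    hρ.toIsRightComodule]
  simp

end SmashCoproduct

/-! ### Projection to B and inclusion of H. -/

section Projections

variable (K H B : Type*) [Field K] [Ring H] [Bialgebra K H] [Ring B] [Algebra K B]

/-- `x ⊗ b ↦ ε(x) b`. -/
noncomputable def projRight : H ⊗[K] B →ₗ[K] B :=
  (TensorProduct.lid K B).toLinearMap ∘ₗ (counit (R := K) (A := H)).rTensor B

/-- `x ↦ x ⊗ 1`. -/
noncomputable def inclLeft : H →ₗ[K] H ⊗[K] B := (TensorProduct.mk K H B).flip 1

variable {K H B}

theorem projRight_tmul (x : H) (b : B) :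
    projRight K H B (x ⊗ₜ b) = counit (R := K) x • b := rfl

theorem inclLeft_apply (x : H) : inclLeft K H B x = x ⊗ₜ 1 := rfl

/-- The counit absorbs the first leg. In particular f is determined by x ↦ x₁ ⊗ f(x₂), which is how
conditions are recovered from identities carrying a spare leg x₁. -/
theorem projRight_lTensor_comul {M : Type*} [AddCommGroup M] [Module K M] (f : H →ₗ[K] M) (x : H) :
    TensorProduct.lid K M ((counit (R := K) (A := H)).rTensor M (f.lTensor H (comul (R := K) x))) =
      f x := by
  rw [← LinearMap.comp_apply (LinearMap.rTensor M _), LinearMap.rTensor_comp_lTensor,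
    ← LinearMap.lTensor_comp_rTensor, LinearMap.comp_apply]
  simp

theorem comul₃_eq (x : H) :
    comul₃ (K := K) x =
      (TensorProduct.assoc K H H H).symm ((comul (R := K)).lTensor H (comul (R := K) x)) :=
  (coassoc_symm_apply x).symm

end Projections

/-! ### Products of the generators x ⊗ 1 and 1 ⊗ b. -/

section CrossedProduct

variable {K H B : Type*} [Field K] [Ring H] [Bialgebra K H] [Ring B] [Algebra K B]
variable {act : B →ₗ[K] H →ₗ[K] B} {τ : H →ₗ[K] H →ₗ[K] B}

theorem mul_map_act_one (hact : IsRightWeakAction act) (f : H →ₗ[K] B) (x : H) :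
    LinearMap.mul' K B (TensorProduct.map f (act 1) (comul (R := K) x)) = f x := by
  have h : ∀ t : H ⊗[K] H, LinearMap.mul' K B (TensorProduct.map f (act 1) t) =
      f (TensorProduct.rid K H ((counit (R := K)).lTensor H t)) := by
    intro t
    induction t with
    | zero => simp
    | add r₁ r₂ h₁ h₂ => simp only [map_add, h₁, h₂]
    | tmul a b => simp [hact.one_act]
  rw [h]
  simp

/-- ε_H is multiplicative, so it absorbs the first leg of each factor and leaves τ(y, x₁)(b ◁ x₂) c.
The coproduct is rebracketed by `comul₃_eq` to expose that leg. -/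
theorem projRight_crossedMul (x y : H) (b c : B) :
    projRight K H B (crossedMul act τ (y ⊗ₜ b) (x ⊗ₜ c)) =
      LinearMap.mul' K B (TensorProduct.map (τ y) (act b) (comul (R := K) x)) * c := by
  have h : ∀ (t : H ⊗[K] H) (r : H ⊗[K] (H ⊗[K] H)),
      projRight K H B (twist H act τ
        ((t ⊗ₜ b) ⊗ₜ ((TensorProduct.assoc K H H H).symm r ⊗ₜ c))) =
      LinearMap.mul' K B (TensorProduct.map
        (τ (TensorProduct.lid K H ((counit (R := K)).rTensor H t))) (act b)
        (TensorProduct.lid K _ ((counit (R := K)).rTensor (H ⊗[K] H) r))) * c := by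
    intro t r
    induction t with
    | zero => simp
    | add r₁ r₂ h₁ h₂ =>
      simp only [map_add, add_tmul, h₁, h₂, map_add_left, add_mul, LinearMap.add_apply]
    | tmul p q =>
      induction r with
      | zero => simp
      | add r₁ r₂ h₁ h₂ => simp only [map_add, add_tmul, tmul_add, h₁, h₂, add_mul]
      | tmul u v =>
        induction v with
        | zero => simp
        | add r₁ r₂ h₁ h₂ => simp only [map_add, add_tmul, tmul_add, h₁, h₂, add_mul]
        | tmul v w =>
          simp [twist_tmul, projRight_tmul, map_smul_left, mul_smul]
          rw [smul_comm]
  rw [crossedMul_tmul, comul₃_eq, h, projRight_lTensor_comul]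
  simp

/-- Normalisation of τ is a consequence of the left unit law, read after applying ε_H to the first
factor. -/
theorem cocycle_one_left (hact : IsRightWeakAction act)
    (halg : IsUnitalAssociative (crossedMul act τ) ((1 : H) ⊗ₜ[K] (1 : B))) (x : H) :
    τ 1 x = counit (R := K) x • (1 : B) := by
  have := congrArg (projRight K H B) (halg.one_left (x ⊗ₜ 1))
  simpa only [projRight_crossedMul, mul_map_act_one hact, mul_one, projRight_tmul] using this

/-- Since 1 ◁ x = ε(x) 1, the third leg of y disappears. -/
theorem crossedMul_left (hact : IsRightWeakAction act) (x y : H) (b : B) :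
    crossedMul act τ (x ⊗ₜ 1) (y ⊗ₜ b) = mulLast H (mulCocycle τ x y ⊗ₜ b) := by
  have h : ∀ (t : H ⊗[K] H) (r : (H ⊗[K] H) ⊗[K] H),
      twist H act τ ((t ⊗ₜ 1) ⊗ₜ (r ⊗ₜ b)) =
      mulLast H (TensorProduct.map (LinearMap.mul' K H) (TensorProduct.lift τ)
        (tensorTensorTensorComm K H H H H
          (t ⊗ₜ TensorProduct.rid K _ ((counit (R := K)).lTensor (H ⊗[K] H) r))) ⊗ₜ b) := by
    intro t r
    induction t with
    | zero => simp
    | add r₁ r₂ h₁ h₂ => simp only [map_add, add_tmul, h₁, h₂]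
    | tmul p q =>
      induction r with
      | zero => simp
      | add r₁ r₂ h₁ h₂ => simp only [map_add, add_tmul, tmul_add, h₁, h₂]
      | tmul u w =>
        induction u with
        | zero => simp
        | add r₁ r₂ h₁ h₂ => simp only [map_add, add_tmul, tmul_add, h₁, h₂]
        | tmul u v =>
          simp [twist_tmul, hact.one_act]
          rw [← smul_tmul', map_smul, mulLast_tmul]
  have h₃ : TensorProduct.rid K _ ((counit (R := K)).lTensor (H ⊗[K] H) (comul₃ (K := K) y)) =
      comul (R := K) y := by
    rw [comul₃, LinearMap.comp_apply, ← LinearMap.comp_apply, LinearMap.lTensor_comp_rTensor,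
      ← LinearMap.rTensor_comp_lTensor, LinearMap.comp_apply]
    simp
  rw [crossedMul_tmul, h, h₃]
  rfl

theorem mulCocycle_one_right (hact : IsRightWeakAction act)
    (halg : IsUnitalAssociative (crossedMul act τ) ((1 : H) ⊗ₜ[K] (1 : B))) (x : H) :
    mulCocycle τ x 1 = x ⊗ₜ 1 := by
  have h := halg.right_one (x ⊗ₜ 1)
  rw [crossedMul_left hact] at h
  rw [← h]
  induction mulCocycle τ x 1 with
  | zero => simp
  | add r₁ r₂ h₁ h₂ => simp only [map_add, add_tmul, ← h₁, ← h₂]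
  | tmul p q => simp [mulLast_tmul]

/-- The factorisation that makes H ⊗ 1 and 1 ⊗ B generate; it rests on the right unit law through
`mulCocycle_one_right`. -/
theorem crossedMul_left_right (hact : IsRightWeakAction act)
    (halg : IsUnitalAssociative (crossedMul act τ) ((1 : H) ⊗ₜ[K] (1 : B))) (x : H) (b : B) :
    crossedMul act τ (x ⊗ₜ 1) (1 ⊗ₜ b) = x ⊗ₜ b := by
  rw [crossedMul_left hact, mulCocycle_one_right hact halg, mulLast_tmul, one_mul]

theorem crossedMul_left_left (hact : IsRightWeakAction act) (x y : H) :
    crossedMul act τ (x ⊗ₜ 1) (y ⊗ₜ 1) =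
      TensorProduct.map (LinearMap.mul' K H) (TensorProduct.lift τ) (comulPair x y) := by
  rw [crossedMul_left hact]
  change mulLast H (TensorProduct.map (LinearMap.mul' K H) (TensorProduct.lift τ)
    (comulPair x y) ⊗ₜ 1) = _
  induction TensorProduct.map (LinearMap.mul' K H) (TensorProduct.lift τ) (comulPair x y) with
  | zero => simp
  | add r₁ r₂ h₁ h₂ => simp only [map_add, add_tmul, h₁, h₂]
  | tmul p q => simp [mulLast_tmul]

/-- Since τ(1, x) = ε(x) 1, the middle leg of x disappears. -/
theorem crossedMul_right (hact : IsRightWeakAction act)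
    (halg : IsUnitalAssociative (crossedMul act τ) ((1 : H) ⊗ₜ[K] (1 : B))) (b c : B) (x : H) :
    crossedMul act τ (1 ⊗ₜ b) (x ⊗ₜ c) =
      mulLast H ((act b).lTensor H (comul (R := K) x) ⊗ₜ c) := by
  have h : ∀ r : (H ⊗[K] H) ⊗[K] H,
      twist H act τ (((1 ⊗ₜ 1) ⊗ₜ b) ⊗ₜ (r ⊗ₜ c)) =
      mulLast H ((act b).lTensor H (((TensorProduct.rid K H).toLinearMap ∘ₗ
        (counit (R := K)).lTensor H).rTensor H r) ⊗ₜ c) := by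
    intro r
    induction r with
    | zero => simp
    | add r₁ r₂ h₁ h₂ => simp only [map_add, add_tmul, tmul_add, h₁, h₂]
    | tmul u w =>
      induction u with
      | zero => simp
      | add r₁ r₂ h₁ h₂ => simp only [map_add, add_tmul, tmul_add, h₁, h₂]
      | tmul u v =>
        simp [twist_tmul, mulLast_tmul, cocycle_one_left hact halg, ← smul_tmul']
  have h₃ : ((TensorProduct.rid K H).toLinearMap ∘ₗ (counit (R := K)).lTensor H).rTensor H
      (comul₃ (K := K) x) = comul (R := K) x := by
    have : ((TensorProduct.rid K H).toLinearMap ∘ₗ (counit (R := K) (A := H)).lTensor H) ∘ₗ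
        comul = LinearMap.id := by ext; simp
    rw [comul₃, LinearMap.comp_apply, ← LinearMap.comp_apply, ← LinearMap.rTensor_comp, this]
    simp
  rw [crossedMul_tmul, Bialgebra.comul_one, Algebra.TensorProduct.one_def, h, h₃]

theorem crossedMul_right_left (hact : IsRightWeakAction act)
    (halg : IsUnitalAssociative (crossedMul act τ) ((1 : H) ⊗ₜ[K] (1 : B))) (b : B) (x : H) :
    crossedMul act τ (1 ⊗ₜ b) (x ⊗ₜ 1) = (act b).lTensor H (comul (R := K) x) := by
  rw [crossedMul_right hact halg]
  induction (act b).lTensor H (comul (R := K) x) with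
  | zero => simp
  | add r₁ r₂ h₁ h₂ => simp only [map_add, add_tmul, h₁, h₂]
  | tmul p q => simp [mulLast_tmul]

theorem crossedMul_right_right (hact : IsRightWeakAction act)
    (halg : IsUnitalAssociative (crossedMul act τ) ((1 : H) ⊗ₜ[K] (1 : B))) (b c : B) :
    crossedMul act τ (1 ⊗ₜ b) (1 ⊗ₜ c) = (1 : H) ⊗ₜ (b * c) := by
  rw [crossedMul_right hact halg]
  simp [Algebra.TensorProduct.one_def, mulLast_tmul, hact.act_one]

theorem projRight_left_left (hact : IsRightWeakAction act) (x y : H) :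
    projRight K H B (crossedMul act τ (x ⊗ₜ 1) (y ⊗ₜ 1)) = τ x y := by
  rw [projRight_crossedMul, mul_map_act_one hact, mul_one]

theorem projRight_right_left (hact : IsRightWeakAction act)
    (halg : IsUnitalAssociative (crossedMul act τ) ((1 : H) ⊗ₜ[K] (1 : B))) (b : B) (x : H) :
    projRight K H B (crossedMul act τ (1 ⊗ₜ b) (x ⊗ₜ 1)) = act b x := by
  rw [crossedMul_right_left hact halg]
  exact projRight_lTensor_comul (act b) x

end CrossedProduct

/-! ### Projections and inclusions against the smash coproduct. -/

section Coproduct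

variable {K H B : Type*} [Field K] [Ring H] [Bialgebra K H] [Ring B] [Algebra K B]
  [Coalgebra K B]
variable {act : B →ₗ[K] H →ₗ[K] B} {τ : H →ₗ[K] H →ₗ[K] B}

variable (K H B) in
/-- `x ⊗ b ↦ ε(b) x`. -/
noncomputable def projLeft : H ⊗[K] B →ₗ[K] H :=
  (TensorProduct.rid K H).toLinearMap ∘ₗ (counit (R := K) (A := B)).lTensor H

theorem projLeft_tmul (x : H) (b : B) :
    projLeft K H B (x ⊗ₜ b) = counit (R := K) b • x := rfl

/-- ε_B passes through the product in B, τ and the action, leaving only counits of H, which absorb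
all legs but the first ones. -/
theorem projLeft_crossedMul
    (hτ : ∀ x x' : H, counit (R := K) (τ x x') = counit (R := K) x * counit (R := K) x')
    (hmul : ∀ b b' : B, counit (R := K) (b * b') = counit (R := K) b * counit (R := K) b')
    (hcact : ∀ b x, counit (R := K) (act b x) = counit (R := K) b * counit (R := K) x)
    (x y : H) (b c : B) :
    projLeft K H B (crossedMul act τ (x ⊗ₜ b) (y ⊗ₜ c)) =
      (counit (R := K) b * counit (R := K) c) • (x * y) := by
  have h : ∀ (t : H ⊗[K] H) (r : (H ⊗[K] H) ⊗[K] H),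
      projLeft K H B (twist H act τ ((t ⊗ₜ b) ⊗ₜ (r ⊗ₜ c))) =
      (counit (R := K) b * counit (R := K) c) •
        (TensorProduct.rid K H ((counit (R := K)).lTensor H t) *
          TensorProduct.rid K H ((counit (R := K)).lTensor H
            (TensorProduct.rid K _ ((counit (R := K)).lTensor (H ⊗[K] H) r)))) := by
    intro t r
    induction t with
    | zero => simp
    | add r₁ r₂ h₁ h₂ => simp only [map_add, add_tmul, add_mul, smul_add, h₁, h₂]
    | tmul p q =>
      induction r with
      | zero => simp
      | add r₁ r₂ h₁ h₂ => simp only [map_add, add_tmul, tmul_add, mul_add, smul_add, h₁, h₂]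
      | tmul u w =>
        induction u with
        | zero => simp
        | add r₁ r₂ h₁ h₂ => simp only [map_add, add_tmul, tmul_add, mul_add, smul_add, h₁, h₂]
        | tmul u v =>
          simp only [twist_tmul, projLeft_tmul, hmul, hτ, hcact, LinearMap.lTensor_tmul, rid_tmul,
            map_smul, smul_smul, smul_mul_assoc, mul_smul_comm]
          congr 1
          ring
  have h₃ : TensorProduct.rid K _ ((counit (R := K)).lTensor (H ⊗[K] H) (comul₃ (K := K) y)) =
      comul (R := K) y := by
    rw [comul₃, LinearMap.comp_apply, ← LinearMap.comp_apply, LinearMap.lTensor_comp_rTensor,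
      ← LinearMap.rTensor_comp_lTensor, LinearMap.comp_apply]
    simp
  rw [crossedMul_tmul, h, h₃]
  simp

theorem counit_projRight (a : H ⊗[K] B) :
    counit (R := K) (projRight K H B a) = smashCounit (K := K) a := by
  induction a with
  | zero => simp
  | add r₁ r₂ h₁ h₂ => simp only [map_add, h₁, h₂]
  | tmul x b => simp [projRight_tmul, smashCounit_tmul]

/-- The factor ε(x₁) ε(x₂ b_1[1]) reduces to ε(x) ε(b_1[1]), and the counit of the coaction removes
b_1[1]. -/
theorem map_projRight_smashComul {ρ : B →ₗ[K] B ⊗[K] H} (hρ : IsRightComodule ρ)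
    (a : H ⊗[K] B) :
    TensorProduct.map (projRight K H B) (projRight K H B) (smashComul ρ a) =
      comul (projRight K H B a) := by
  induction a with
  | zero => simp
  | add r₁ r₂ h₁ h₂ => simp only [map_add, h₁, h₂]
  | tmul x b =>
    have h : ∀ (t : H ⊗[K] H) (s : (B ⊗[K] H) ⊗[K] B),
        TensorProduct.map (projRight K H B) (projRight K H B) (smashShape (t ⊗ₜ s)) =
          counit (R := K) (TensorProduct.rid K H ((counit (R := K)).lTensor H t)) •
            ((TensorProduct.rid K B).toLinearMap ∘ₗ
                (counit (R := K) (A := H)).lTensor B).rTensor B s := by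
      intro t s
      induction t with
      | zero => simp
      | add r₁ r₂ h₁ h₂ => simp only [map_add, add_tmul, add_smul, h₁, h₂]
      | tmul x y =>
        induction s with
        | zero => simp
        | add r₁ r₂ h₁ h₂ => simp only [map_add, tmul_add, smul_add, h₁, h₂]
        | tmul u b =>
          induction u with
          | zero => simp
          | add r₁ r₂ h₁ h₂ => simp only [map_add, tmul_add, add_tmul, smul_add, h₁, h₂]
          | tmul c h =>
            simp only [smashShape_tmul, map_tmul, projRight_tmul, LinearMap.lTensor_tmul,
              LinearMap.rTensor_tmul, LinearMap.comp_apply, rid_tmul, map_smul,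
              Bialgebra.counit_mul, LinearEquiv.coe_coe, tmul_smul, ← smul_tmul', smul_smul,
              smul_eq_mul]
            congr 1
            ring
    rw [smashComul_tmul', h, lTensor_counit_rTensor_coactFst hρ, projRight_tmul]
    simp

/-- ε_H removes x₁ and ε_B removes b_2, so what survives is the coaction b_[0] ⊗ x b_[1]. -/
theorem map_projRight_projLeft_smashComul (ρ : B →ₗ[K] B ⊗[K] H) (x : H) (b : B) :
    TensorProduct.map (projRight K H B) (projLeft K H B) (smashComul ρ (x ⊗ₜ b)) =
      1 ⊗ₜ x * ρ b := by
  have h : ∀ (t : H ⊗[K] H) (s : (B ⊗[K] H) ⊗[K] B),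
      TensorProduct.map (projRight K H B) (projLeft K H B) (smashShape (t ⊗ₜ s)) =
        1 ⊗ₜ (TensorProduct.lid K H ((counit (R := K)).rTensor H t)) *
          TensorProduct.rid K _ ((counit (R := K) (A := B)).lTensor (B ⊗[K] H) s) := by
    intro t s
    induction t with
    | zero => simp
    | add r₁ r₂ h₁ h₂ => simp only [map_add, add_tmul, tmul_add, add_mul, h₁, h₂]
    | tmul x y =>
      induction s with
      | zero => simp
      | add r₁ r₂ h₁ h₂ => simp only [map_add, tmul_add, mul_add, h₁, h₂]
      | tmul u b =>
        induction u with
        | zero => simp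
        | add r₁ r₂ h₁ h₂ => simp only [map_add, tmul_add, add_tmul, mul_add, h₁, h₂]
        | tmul c h =>
          simp [smashShape_tmul, projRight_tmul, projLeft_tmul, smul_smul, ← smul_tmul']
  rw [smashComul_tmul', h, lTensor_counit_coactFst]
  simp

theorem coactFst_one {ρ : B →ₗ[K] B ⊗[K] H} (hΔ : comul (R := K) (1 : B) = 1 ⊗ₜ[K] 1)
    (hρ : ρ 1 = 1 ⊗ₜ[K] 1) : coactFst ρ 1 = (1 ⊗ₜ 1) ⊗ₜ 1 := by
  simp [coactFst, hΔ, hρ]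

/-- As 1_B is grouplike and coinvariant, nothing of B enters the coproduct of x ⊗ 1. -/
theorem smashComul_left {ρ : B →ₗ[K] B ⊗[K] H} (hΔ : comul (R := K) (1 : B) = 1 ⊗ₜ[K] 1)
    (hρ : ρ 1 = 1 ⊗ₜ[K] 1) (x : H) :
    smashComul ρ (x ⊗ₜ 1) =
      TensorProduct.map (inclLeft K H B) (inclLeft K H B) (comul (R := K) x) := by
  rw [smashComul_tmul', coactFst_one hΔ hρ]
  induction comul (R := K) x with
  | zero => simp
  | add r₁ r₂ h₁ h₂ => simp only [map_add, add_tmul, h₁, h₂]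
  | tmul x y => simp [smashShape_tmul, inclLeft_apply]

theorem smashComul_right (ρ : B →ₗ[K] B ⊗[K] H) (b : B) :
    smashComul ρ ((1 : H) ⊗ₜ b) = smashShape ((1 ⊗ₜ 1) ⊗ₜ coactFst ρ b) := by
  rw [smashComul_tmul', Bialgebra.comul_one, Algebra.TensorProduct.one_def]

/-- Comodule coassociativity trades the iterated coaction for the coproduct of b_1[1], the form in
which the crossed product consumes it. -/
theorem coactFst₂_eq {ρ : B →ₗ[K] B ⊗[K] H} (hρ : IsRightComodule ρ) (b : B) :
    coactFst₂ ρ b = ((TensorProduct.assoc K B H H).symm.toLinearMap ∘ₗ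
      (comul (R := K) (A := H)).lTensor B).rTensor B (coactFst ρ b) := by
  have : ρ.rTensor H ∘ₗ ρ = ((TensorProduct.assoc K B H H).symm.toLinearMap ∘ₗ
      (comul (R := K) (A := H)).lTensor B) ∘ₗ ρ := by
    ext b
    exact (LinearEquiv.eq_symm_apply _).2 (hρ.coassoc b)
  rw [coactFst₂, this, LinearMap.rTensor_comp]
  rfl

end Coproduct

/-! ### The products (x ⊗ 1)(1 ⊗ b). -/

section Regrouping

variable {K H B : Type*} [Field K] [Ring H] [Bialgebra K H] [Ring B] [Algebra K B]
variable {act : B →ₗ[K] H →ₗ[K] B} {τ : H →ₗ[K] H →ₗ[K] B}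

variable (K H B) in
/-- `x ⊗ ((b ⊗ h) ⊗ c) ↦ (x ⊗ b) ⊗ (h ⊗ c)`. -/
noncomputable def regroup :
    H ⊗[K] ((B ⊗[K] H) ⊗[K] B) ≃ₗ[K] (H ⊗[K] B) ⊗[K] (H ⊗[K] B) :=
  (TensorProduct.assoc K B H B).lTensor H ≪≫ₗ (TensorProduct.assoc K H B (H ⊗[K] B)).symm

theorem regroup_tmul (x h : H) (b c : B) :
    regroup K H B (x ⊗ₜ ((b ⊗ₜ h) ⊗ₜ c)) = (x ⊗ₜ b) ⊗ₜ (h ⊗ₜ c) := rfl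

/-- `x ↦ b ⊗ x h ⊗ c`, for `s = (b ⊗ h) ⊗ c`. -/
noncomputable def mulMiddle (s : (B ⊗[K] H) ⊗[K] B) : H →ₗ[K] (B ⊗[K] H) ⊗[K] B :=
  (LinearMap.rTensorHom B ∘ₗ LinearMap.lTensorHom B ∘ₗ LinearMap.mul K H).flip s

theorem mulMiddle_apply (s : (B ⊗[K] H) ⊗[K] B) (x : H) :
    mulMiddle s x = ((LinearMap.mulLeft K x).lTensor B).rTensor B s := rfl

/-- `x ↦ b ⊗ x₁ h₁ ⊗ τ(x₂, h₂) c`, for `s = (b ⊗ h) ⊗ c`. -/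
noncomputable def mulMiddleCocycle (τ : H →ₗ[K] H →ₗ[K] B) (s : (B ⊗[K] H) ⊗[K] B) :
    H →ₗ[K] (B ⊗[K] H) ⊗[K] B :=
  mulLast (B ⊗[K] H) ∘ₗ
    (LinearMap.rTensorHom B ∘ₗ
      LinearMap.llcomp K (B ⊗[K] H) (B ⊗[K] (H ⊗[K] B)) ((B ⊗[K] H) ⊗[K] B)
        (TensorProduct.assoc K B H B).symm.toLinearMap ∘ₗ
      LinearMap.lTensorHom B ∘ₗ
      ((TensorProduct.mk K _ _).compr₂
        (TensorProduct.map (LinearMap.mul' K H) (TensorProduct.lift τ) ∘ₗ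
          (tensorTensorTensorComm K H H H H).toLinearMap)).compl₁₂ comul comul).flip s

theorem mulMiddleCocycle_apply (s : (B ⊗[K] H) ⊗[K] B) (x : H) :
    mulMiddleCocycle τ s x = mulLast (B ⊗[K] H)
        (((TensorProduct.assoc K B H B).symm.toLinearMap ∘ₗ
          (mulCocycle τ x).lTensor B).rTensor B s) := rfl

/-- Together with `tensorMul_left_smashShape`, this writes both sides of multiplicativity as x₁ ⊗
F(x₂) up to one rebracketing, so that only the two maps F have to be compared. -/
theorem smashShape_eq_regroup (t : H ⊗[K] H) (s : (B ⊗[K] H) ⊗[K] B) :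
    smashShape (t ⊗ₜ s) = regroup K H B ((mulMiddle s).lTensor H t) := by
  induction t with
  | zero => simp
  | add r₁ r₂ h₁ h₂ => simp only [map_add, add_tmul, h₁, h₂]
  | tmul x y =>
    simp only [LinearMap.lTensor_tmul, mulMiddle_apply]
    induction s with
    | zero => simp
    | add r₁ r₂ h₁ h₂ => simp only [map_add, tmul_add, h₁, h₂]
    | tmul u b =>
      induction u with
      | zero => simp
      | add r₁ r₂ h₁ h₂ => simp only [map_add, tmul_add, add_tmul, h₁, h₂]
      | tmul c h => simp [smashShape_tmul, regroup_tmul]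

theorem tensorMul_left_smashShape (hact : IsRightWeakAction act)
    (halg : IsUnitalAssociative (crossedMul act τ) ((1 : H) ⊗ₜ[K] (1 : B)))
    (t : H ⊗[K] H) (s : (B ⊗[K] H) ⊗[K] B) :
    tensorMul (crossedMul act τ) (TensorProduct.map (inclLeft K H B) (inclLeft K H B) t)
      (smashShape ((1 ⊗ₜ 1) ⊗ₜ s)) = regroup K H B ((mulMiddleCocycle τ s).lTensor H t) := by
  induction t with
  | zero => simp
  | add r₁ r₂ h₁ h₂ => simp only [map_add, LinearMap.add_apply, h₁, h₂]
  | tmul x y =>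
    simp only [LinearMap.lTensor_tmul, mulMiddleCocycle_apply]
    induction s with
    | zero => simp
    | add r₁ r₂ h₁ h₂ => simp only [map_add, tmul_add, h₁, h₂]
    | tmul u b =>
      induction u with
      | zero => simp
      | add r₁ r₂ h₁ h₂ => simp only [map_add, tmul_add, add_tmul, h₁, h₂]
      | tmul c h =>
        simp only [map_tmul, smashShape_tmul, tensorMul_tmul, inclLeft_apply, one_mul,
          crossedMul_left_right hact halg, crossedMul_left hact, LinearMap.rTensor_tmul,
          LinearMap.comp_apply, LinearMap.lTensor_tmul]
        induction mulCocycle τ y h with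
        | zero => simp
        | add r₁ r₂ h₁ h₂ => simp only [map_add, tmul_add, add_tmul, h₁, h₂]
        | tmul p q => simp [mulLast_tmul, regroup_tmul]

end Regrouping

/-! ### From a bialgebra to the compatibility conditions. -/

section Necessity

variable {K H B : Type*} [Field K] [Ring H] [Bialgebra K H] [Ring B] [Algebra K B]
  [Coalgebra K B]
variable {act : B →ₗ[K] H →ₗ[K] B} {τ : H →ₗ[K] H →ₗ[K] B} {ρ : B →ₗ[K] B ⊗[K] H}

theorem counit_act_of_multiplicative (hact : IsRightWeakAction act)
    (halg : IsUnitalAssociative (crossedMul act τ) ((1 : H) ⊗ₜ[K] (1 : B)))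
    (hε : ∀ v w : H ⊗[K] B, smashCounit (K := K) (crossedMul act τ v w) =
      smashCounit (K := K) v * smashCounit (K := K) w)
    (hε₁ : counit (R := K) (1 : B) = 1) (b : B) (x : H) :
    counit (R := K) (act b x) = counit (R := K) b * counit (R := K) x := by
  have := hε (1 ⊗ₜ b) (x ⊗ₜ 1)
  rw [← counit_projRight, projRight_right_left hact halg] at this
  simpa [smashCounit_tmul, hε₁] using this

theorem comul_mul_of_multiplicative (hact : IsRightWeakAction act) (hρ : IsRightComodule ρ)
    (halg : IsUnitalAssociative (crossedMul act τ) ((1 : H) ⊗ₜ[K] (1 : B)))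
    (hΔ : ∀ v w, smashComul ρ (crossedMul act τ v w) =
      tensorMul (crossedMul act τ) (smashComul ρ v) (smashComul ρ w)) (b b' : B) :
    comul (R := K) (b * b') = twist B act τ (coactFst ρ b ⊗ₜ coactFst₂ ρ b') := by
  have h := congrArg (TensorProduct.map (projRight K H B) (projRight K H B))
    (hΔ (1 ⊗ₜ b) (1 ⊗ₜ b'))
  rw [map_projRight_smashComul hρ, crossedMul_right_right hact halg, projRight_tmul,
    Bialgebra.counit_one, one_smul, smashComul_right, smashComul_right] at h
  rw [h, coactFst₂_eq hρ]
  generalize coactFst ρ b = s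
  generalize coactFst ρ b' = t
  induction s with
  | zero => simp
  | add r₁ r₂ h₁ h₂ => simp only [map_add, LinearMap.add_apply, tmul_add, add_tmul, h₁, h₂]
  | tmul u c =>
    induction u with
    | zero => simp
    | add r₁ r₂ h₁ h₂ => simp only [map_add, LinearMap.add_apply, tmul_add, add_tmul, h₁, h₂]
    | tmul a x =>
      induction t with
      | zero => simp
      | add r₁ r₂ h₁ h₂ => simp only [map_add, tmul_add, h₁, h₂]
      | tmul v c' =>
        induction v with
        | zero => simp
        | add r₁ r₂ h₁ h₂ => simp only [map_add, tmul_add, add_tmul, h₁, h₂]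
        | tmul a' x' =>
          simp only [smashShape_tmul, tensorMul_tmul, map_tmul, one_mul,
            crossedMul_right_right hact halg, projRight_crossedMul, LinearMap.rTensor_tmul,
            LinearMap.comp_apply, LinearMap.lTensor_tmul, projRight_tmul, Bialgebra.counit_one,
            one_smul]
          induction comul (R := K) x' with
          | zero => simp
          | add r₁ r₂ h₁ h₂ => simp only [map_add, tmul_add, add_tmul, add_mul, h₁, h₂]
          | tmul y z => simp [twist_tmul]

/-- Apply `projRight` ⊗ `projLeft` to the coproduct of (1 ⊗ b)(1 ⊗ b'). The second leg needs the
multiplicativity of ε_B and its compatibility with τ and the action. -/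
theorem coact_mul_of_multiplicative (hact : IsRightWeakAction act)
    (halg : IsUnitalAssociative (crossedMul act τ) ((1 : H) ⊗ₜ[K] (1 : B)))
    (hτ : ∀ x x' : H, counit (R := K) (τ x x') = counit (R := K) x * counit (R := K) x')
    (hmul : ∀ b b' : B, counit (R := K) (b * b') = counit (R := K) b * counit (R := K) b')
    (hcact : ∀ b x, counit (R := K) (act b x) = counit (R := K) b * counit (R := K) x)
    (hΔ : ∀ v w, smashComul ρ (crossedMul act τ v w) =
      tensorMul (crossedMul act τ) (smashComul ρ v) (smashComul ρ w)) (b b' : B) :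
    ρ (b * b') = ρ b * ρ b' := by
  have h := congrArg (TensorProduct.map (projRight K H B) (projLeft K H B))
    (hΔ (1 ⊗ₜ b) (1 ⊗ₜ b'))
  rw [crossedMul_right_right hact halg, map_projRight_projLeft_smashComul,
    smashComul_right, smashComul_right, ← Algebra.TensorProduct.one_def, one_mul] at h
  have hs : ∀ b, ρ b =
      TensorProduct.rid K _ ((counit (R := K) (A := B)).lTensor (B ⊗[K] H) (coactFst ρ b)) := by
    intro b
    rw [lTensor_counit_coactFst]
    simp
  rw [h, hs b, hs b']
  generalize coactFst ρ b = s
  generalize coactFst ρ b' = t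
  induction s with
  | zero => simp
  | add r₁ r₂ h₁ h₂ => simp only [map_add, LinearMap.add_apply, tmul_add, add_mul, h₁, h₂]
  | tmul u c =>
    induction u with
    | zero => simp
    | add r₁ r₂ h₁ h₂ =>
      simp only [map_add, LinearMap.add_apply, tmul_add, add_tmul, add_mul, h₁, h₂]
    | tmul a x =>
      induction t with
      | zero => simp
      | add r₁ r₂ h₁ h₂ => simp only [map_add, tmul_add, mul_add, h₁, h₂]
      | tmul v c' =>
        induction v with
        | zero => simp
        | add r₁ r₂ h₁ h₂ => simp only [map_add, tmul_add, add_tmul, mul_add, h₁, h₂]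
        | tmul a' x' =>
          simp only [smashShape_tmul, tensorMul_tmul, map_tmul, one_mul,
            crossedMul_right_right hact halg, projLeft_crossedMul hτ hmul hcact,
            LinearMap.lTensor_tmul, projRight_tmul, Bialgebra.counit_one,
            one_smul, rid_tmul, smul_mul_smul_comm, Algebra.TensorProduct.tmul_mul_tmul, tmul_smul]

theorem comul_cocycle_of_multiplicative (hact : IsRightWeakAction act) (hρ : IsRightComodule ρ)
    (hΔ₁ : comul (R := K) (1 : B) = 1 ⊗ₜ[K] 1) (hρ₁ : ρ 1 = 1 ⊗ₜ[K] 1)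
    (hΔ : ∀ v w, smashComul ρ (crossedMul act τ v w) =
      tensorMul (crossedMul act τ) (smashComul ρ v) (smashComul ρ w)) (x x' : H) :
    comul (R := K) (τ x x') =
      TensorProduct.map (TensorProduct.lift τ) (TensorProduct.lift τ) (comulPair x x') := by
  have h := congrArg (TensorProduct.map (projRight K H B) (projRight K H B))
    (hΔ (x ⊗ₜ 1) (x' ⊗ₜ 1))
  rw [map_projRight_smashComul hρ, projRight_left_left hact, smashComul_left hΔ₁ hρ₁,
    smashComul_left hΔ₁ hρ₁] at h
  rw [h, comulPair]
  generalize comul (R := K) x = s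
  generalize comul (R := K) x' = t
  induction s with
  | zero => simp
  | add r₁ r₂ h₁ h₂ => simp only [map_add, LinearMap.add_apply, add_tmul, h₁, h₂]
  | tmul a b =>
    induction t with
    | zero => simp
    | add r₁ r₂ h₁ h₂ => simp only [map_add, tmul_add, h₁, h₂]
    | tmul c d =>
      simp [inclLeft_apply, tensorMul_tmul, projRight_left_left hact]

theorem coact_cocycle_of_multiplicative (hact : IsRightWeakAction act)
    (hτ : ∀ x x' : H, counit (R := K) (τ x x') = counit (R := K) x * counit (R := K) x')
    (hmul : ∀ b b' : B, counit (R := K) (b * b') = counit (R := K) b * counit (R := K) b')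
    (hε₁ : counit (R := K) (1 : B) = 1)
    (hcact : ∀ b x, counit (R := K) (act b x) = counit (R := K) b * counit (R := K) x)
    (hΔ₁ : comul (R := K) (1 : B) = 1 ⊗ₜ[K] 1) (hρ₁ : ρ 1 = 1 ⊗ₜ[K] 1)
    (hΔ : ∀ v w, smashComul ρ (crossedMul act τ v w) =
      tensorMul (crossedMul act τ) (smashComul ρ v) (smashComul ρ w)) (x x' : H) :
    LinearMap.mul' K (B ⊗[K] H)
        (TensorProduct.map (TensorProduct.mk K B H 1 ∘ₗ LinearMap.mul' K H)
          (ρ ∘ₗ TensorProduct.lift τ) (comulPair x x')) =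
      TensorProduct.map (TensorProduct.lift τ) (LinearMap.mul' K H) (comulPair x x') := by
  have h := congrArg (TensorProduct.map (projRight K H B) (projLeft K H B))
    (hΔ (x ⊗ₜ 1) (x' ⊗ₜ 1))
  rw [crossedMul_left_left hact, smashComul_left hΔ₁ hρ₁, smashComul_left hΔ₁ hρ₁] at h
  refine Eq.trans ?_ (h.trans ?_)
  · induction comulPair (K := K) x x' with
    | zero => simp
    | add r₁ r₂ h₁ h₂ => simp only [map_add, h₁, h₂]
    | tmul u v => simp [map_projRight_projLeft_smashComul]
  · unfold comulPair
    generalize comul (R := K) x = s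
    generalize comul (R := K) x' = t
    induction s with
    | zero => simp
    | add r₁ r₂ h₁ h₂ => simp only [map_add, LinearMap.add_apply, add_tmul, h₁, h₂]
    | tmul a b =>
      induction t with
      | zero => simp
      | add r₁ r₂ h₁ h₂ => simp only [map_add, tmul_add, h₁, h₂]
      | tmul c d =>
        simp [inclLeft_apply, tensorMul_tmul, projRight_left_left hact,
          projLeft_crossedMul hτ hmul hcact, hε₁]

theorem comul_act_of_multiplicative (hact : IsRightWeakAction act) (hρ : IsRightComodule ρ)
    (halg : IsUnitalAssociative (crossedMul act τ) ((1 : H) ⊗ₜ[K] (1 : B)))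
    (hΔ₁ : comul (R := K) (1 : B) = 1 ⊗ₜ[K] 1) (hρ₁ : ρ 1 = 1 ⊗ₜ[K] 1)
    (hΔ : ∀ v w, smashComul ρ (crossedMul act τ v w) =
      tensorMul (crossedMul act τ) (smashComul ρ v) (smashComul ρ w)) (b : B) (x : H) :
    comul (R := K) (act b x) = actShape act τ (coactFst ρ b ⊗ₜ comul₃ (K := K) x) := by
  have h := congrArg (TensorProduct.map (projRight K H B) (projRight K H B))
    (hΔ (1 ⊗ₜ b) (x ⊗ₜ 1))
  rw [map_projRight_smashComul hρ, projRight_right_left hact halg, smashComul_left hΔ₁ hρ₁,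
    smashComul_right] at h
  rw [h, comul₃_eq]
  generalize coactFst ρ b = s
  induction comul (R := K) x with
  | zero => simp
  | add r₁ r₂ h₁ h₂ => simp only [map_add, tmul_add, h₁, h₂]
  | tmul y z =>
    induction s with
    | zero => simp
    | add r₁ r₂ h₁ h₂ => simp only [map_add, LinearMap.add_apply, tmul_add, add_tmul, h₁, h₂]
    | tmul u c =>
      induction u with
      | zero => simp
      | add r₁ r₂ h₁ h₂ => simp only [map_add, LinearMap.add_apply, tmul_add, add_tmul, h₁, h₂]
      | tmul a h =>
        simp only [smashShape_tmul, tensorMul_tmul, map_tmul, one_mul, inclLeft_apply,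
          projRight_right_left hact halg, projRight_crossedMul, LinearMap.lTensor_tmul, mul_one]
        induction comul (R := K) z with
        | zero => simp
        | add r₁ r₂ h₁ h₂ => simp only [map_add, tmul_add, h₁, h₂]
        | tmul v w => simp [actShape_tmul]

theorem coact_act_of_multiplicative (hact : IsRightWeakAction act)
    (halg : IsUnitalAssociative (crossedMul act τ) ((1 : H) ⊗ₜ[K] (1 : B)))
    (hτ : ∀ x x' : H, counit (R := K) (τ x x') = counit (R := K) x * counit (R := K) x')
    (hmul : ∀ b b' : B, counit (R := K) (b * b') = counit (R := K) b * counit (R := K) b')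
    (hε₁ : counit (R := K) (1 : B) = 1)
    (hcact : ∀ b x, counit (R := K) (act b x) = counit (R := K) b * counit (R := K) x)
    (hΔ₁ : comul (R := K) (1 : B) = 1 ⊗ₜ[K] 1) (hρ₁ : ρ 1 = 1 ⊗ₜ[K] 1)
    (hΔ : ∀ v w, smashComul ρ (crossedMul act τ v w) =
      tensorMul (crossedMul act τ) (smashComul ρ v) (smashComul ρ w)) (b : B) (x : H) :
    LinearMap.mul' K (B ⊗[K] H)
        (TensorProduct.map (TensorProduct.mk K B H 1) (ρ ∘ₗ act b) (comul (R := K) x)) =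
      TensorProduct.map (TensorProduct.lift act) (LinearMap.mul' K H)
        (tensorTensorTensorComm K B H H H (ρ b ⊗ₜ comul (R := K) x)) := by
  have h := congrArg (TensorProduct.map (projRight K H B) (projLeft K H B))
    (hΔ (1 ⊗ₜ b) (x ⊗ₜ 1))
  rw [crossedMul_right_left hact halg, smashComul_left hΔ₁ hρ₁, smashComul_right] at h
  refine Eq.trans ?_ (h.trans ?_)
  · induction comul (R := K) x with
    | zero => simp
    | add r₁ r₂ h₁ h₂ => simp only [map_add, h₁, h₂]
    | tmul u v => simp [map_projRight_projLeft_smashComul]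
  · have hs : ρ b =
        TensorProduct.rid K _ ((counit (R := K) (A := B)).lTensor (B ⊗[K] H) (coactFst ρ b)) := by
      rw [lTensor_counit_coactFst]
      simp
    rw [hs]
    generalize coactFst ρ b = s
    induction comul (R := K) x with
    | zero => simp
    | add r₁ r₂ h₁ h₂ => simp only [map_add, tmul_add, h₁, h₂]
    | tmul y z =>
      induction s with
      | zero => simp
      | add r₁ r₂ h₁ h₂ => simp only [map_add, LinearMap.add_apply, tmul_add, add_tmul, h₁, h₂]
      | tmul u c =>
        induction u with
        | zero => simp
        | add r₁ r₂ h₁ h₂ => simp only [map_add, LinearMap.add_apply, tmul_add, add_tmul, h₁, h₂]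
        | tmul a h =>
          simp [smashShape_tmul, tensorMul_tmul, inclLeft_apply,
            projRight_right_left hact halg, projLeft_crossedMul hτ hmul hcact, hε₁,
            ← smul_tmul']

/-- The multiplicativity of the coproduct on the products `(x ⊗ 1)(1 ⊗ b)`. -/
theorem smashComul_tmul_eq_tensorMul_iff (hact : IsRightWeakAction act)
    (halg : IsUnitalAssociative (crossedMul act τ) ((1 : H) ⊗ₜ[K] (1 : B)))
    (hΔ₁ : comul (R := K) (1 : B) = 1 ⊗ₜ[K] 1) (hρ₁ : ρ 1 = 1 ⊗ₜ[K] 1) (b : B) :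
    (∀ x : H, smashComul ρ (x ⊗ₜ b) =
      tensorMul (crossedMul act τ) (smashComul ρ (x ⊗ₜ 1)) (smashComul ρ (1 ⊗ₜ b))) ↔
    ∀ x : H, ((LinearMap.mulLeft K x).lTensor B).rTensor B (coactFst ρ b) =
      mulLast (B ⊗[K] H)
        (((TensorProduct.assoc K B H B).symm.toLinearMap ∘ₗ
          (mulCocycle τ x).lTensor B).rTensor B (coactFst ρ b)) := by
  simp only [← mulMiddle_apply, ← mulMiddleCocycle_apply]
  have h₁ : ∀ x : H, smashComul ρ (x ⊗ₜ b) =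
      regroup K H B ((mulMiddle (coactFst ρ b)).lTensor H (comul (R := K) x)) :=
    fun x => smashShape_eq_regroup _ _
  have h₂ : ∀ x : H, tensorMul (crossedMul act τ) (smashComul ρ (x ⊗ₜ 1)) (smashComul ρ (1 ⊗ₜ b)) =
      regroup K H B ((mulMiddleCocycle τ (coactFst ρ b)).lTensor H (comul (R := K) x)) := by
    intro x
    rw [smashComul_left hΔ₁ hρ₁, smashComul_right, tensorMul_left_smashShape hact halg]
  simp only [h₂]
  simp only [h₁, EmbeddingLike.apply_eq_iff_eq]
  -- Applying ε_H to the leg x₁ cancels it; conversely, equal maps of x₂ give equal tensors.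
  refine ⟨fun h x => ?_, fun h x => by rw [LinearMap.ext h]⟩
  rw [← projRight_lTensor_comul (mulMiddle (coactFst ρ b)), h, projRight_lTensor_comul]

theorem IsBialgebraWith.compatible (hact : IsRightWeakAction act)
    (hρ : IsRightComoduleCoalgebra ρ)
    (hτ : ∀ x x' : H, counit (R := K) (τ x x') = counit (R := K) x * counit (R := K) x')
    (halg : IsUnitalAssociative (crossedMul act τ) ((1 : H) ⊗ₜ[K] (1 : B)))
    (h : IsBialgebraWith (crossedMul act τ) ((1 : H) ⊗ₜ[K] (1 : B)) (smashComul ρ) smashCounit) :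
    Compatible act τ ρ := by
  obtain ⟨hΔ, hΔ₁, hε, hε₁⟩ := h.multiplicative
  -- The counit conditions and those on 1_B come first, as the remaining projections of Δ(vw) =
  -- Δ(v)Δ(w) are computed with them.
  have counit_one : counit (R := K) (1 : B) = 1 := by simpa [smashCounit_tmul] using hε₁
  have counit_mul : ∀ b b' : B,
      counit (R := K) (b * b') = counit (R := K) b * counit (R := K) b' := by
    intro b b'
    have := hε (1 ⊗ₜ b) (1 ⊗ₜ b')
    rw [crossedMul_right_right hact halg] at this
    simpa [smashCounit_tmul] using this
  have comul_one : comul (R := K) (1 : B) = 1 ⊗ₜ[K] 1 := by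
    have := map_projRight_smashComul hρ.toIsRightComodule (1 ⊗ₜ 1)
    rw [hΔ₁] at this
    simpa [projRight_tmul] using this.symm
  have coact_one : ρ 1 = 1 ⊗ₜ[K] 1 := by
    have : _ = (1 : B ⊗[K] H) * ρ 1 := map_projRight_projLeft_smashComul ρ 1 1
    rw [hΔ₁, one_mul] at this
    simpa [projRight_tmul, projLeft_tmul, counit_one] using this.symm
  have counit_act := counit_act_of_multiplicative hact halg hε counit_one
  exact
    { counit_mul := counit_mul
      counit_one := counit_one
      comul_one := comul_one
      coact_one := coact_one
      counit_act := counit_act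
      twisted_cocycle := fun b =>
        (smashComul_tmul_eq_tensorMul_iff hact halg comul_one coact_one b).1 fun x => by
          rw [← hΔ, crossedMul_left_right hact halg]
      comul_mul := comul_mul_of_multiplicative hact hρ.toIsRightComodule halg hΔ
      coact_mul := coact_mul_of_multiplicative hact halg hτ counit_mul counit_act hΔ
      coact_cocycle := coact_cocycle_of_multiplicative hact hτ counit_mul counit_one counit_act
        comul_one coact_one hΔ
      comul_cocycle := comul_cocycle_of_multiplicative hact hρ.toIsRightComodule comul_one
        coact_one hΔ
      coact_act := coact_act_of_multiplicative hact halg hτ counit_mul counit_one counit_act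
        comul_one coact_one hΔ
      comul_act := comul_act_of_multiplicative hact hρ.toIsRightComodule halg comul_one
        coact_one hΔ }

end Necessity

/-! ### Multiplicativity on (1 ⊗ b)(1 ⊗ b'). -/

section RightRight

variable {K H B : Type*} [Field K] [Ring H] [Bialgebra K H] [Ring B] [Algebra K B]
variable {act : B →ₗ[K] H →ₗ[K] B} {τ : H →ₗ[K] H →ₗ[K] B} {ρ : B →ₗ[K] B ⊗[K] H}

variable (K H B) in
/-- `b ⊗ h ↦ (b ⊗ h₁) ⊗ h₂`. -/
noncomputable def comulLast : B ⊗[K] H →ₗ[K] (B ⊗[K] H) ⊗[K] H :=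
  (TensorProduct.assoc K B H H).symm.toLinearMap ∘ₗ (comul (R := K) (A := H)).lTensor B

theorem comulLast_tmul (b : B) (h : H) :
    comulLast K H B (b ⊗ₜ h) = (TensorProduct.assoc K B H H).symm (b ⊗ₜ comul (R := K) h) := rfl

theorem rTensor_comulLast_comulLast (b : B) (h : H) :
    (comulLast K H B).rTensor H (comulLast K H B (b ⊗ₜ h)) =
      (TensorProduct.assoc K B H H).symm.toLinearMap.rTensor H
        ((TensorProduct.assoc K B (H ⊗[K] H) H).symm (b ⊗ₜ comul₃ (K := K) h)) := by
  rw [comulLast_tmul, comul₃, LinearMap.comp_apply]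
  induction comul (R := K) h with
  | zero => simp
  | add r₁ r₂ h₁ h₂ => simp only [map_add, tmul_add, h₁, h₂]
  | tmul y z => simp [comulLast_tmul]

/-- Multiplicativity of ρ acts on the first tensor factor only; the twisted product in the second is
untouched. -/
theorem rTensor_twist (hρ : ∀ b b' : B, ρ (b * b') = ρ b * ρ b') (s : (B ⊗[K] H) ⊗[K] B)
    (t : ((B ⊗[K] H) ⊗[K] H) ⊗[K] B) :
    ρ.rTensor B (twist B act τ (s ⊗ₜ t)) =
      twist (B ⊗[K] H) act τ ((ρ.rTensor H).rTensor B s ⊗ₜ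
        ((ρ.rTensor H).rTensor H).rTensor B t) := by
  induction s with
  | zero => simp
  | add r₁ r₂ h₁ h₂ => simp only [map_add, add_tmul, h₁, h₂]
  | tmul u c =>
    induction u with
    | zero => simp
    | add r₁ r₂ h₁ h₂ => simp only [map_add, add_tmul, h₁, h₂]
    | tmul a x =>
      induction t with
      | zero => simp
      | add r₁ r₂ h₁ h₂ => simp only [map_add, tmul_add, h₁, h₂]
      | tmul v c' =>
        induction v with
        | zero => simp
        | add r₁ r₂ h₁ h₂ => simp only [map_add, tmul_add, add_tmul, h₁, h₂]
        | tmul w y =>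
          induction w with
          | zero => simp
          | add r₁ r₂ h₁ h₂ => simp only [map_add, tmul_add, add_tmul, h₁, h₂]
          | tmul a' z => simp [twist_tmul, hρ]

/-- Purely formal in s and t: the second factor of the componentwise crossed product takes two legs
of x and three of x', which `comulLast` supplies. -/
theorem smashShape_twist (hact : IsRightWeakAction act)
    (halg : IsUnitalAssociative (crossedMul act τ) ((1 : H) ⊗ₜ[K] (1 : B)))
    (s t : (B ⊗[K] H) ⊗[K] B) :
    smashShape ((1 ⊗ₜ 1) ⊗ₜ twist (B ⊗[K] H) act τ ((comulLast K H B).rTensor B s ⊗ₜ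
        ((comulLast K H B).rTensor H ∘ₗ comulLast K H B).rTensor B t)) =
      tensorMul (crossedMul act τ) (smashShape ((1 ⊗ₜ 1) ⊗ₜ s)) (smashShape ((1 ⊗ₜ 1) ⊗ₜ t)) := by
  induction s with
  | zero => simp
  | add r₁ r₂ h₁ h₂ => simp only [map_add, LinearMap.add_apply, tmul_add, add_tmul, h₁, h₂]
  | tmul u c =>
    induction u with
    | zero => simp
    | add r₁ r₂ h₁ h₂ => simp only [map_add, LinearMap.add_apply, tmul_add, add_tmul, h₁, h₂]
    | tmul a x =>
      induction t with
      | zero => simp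
      | add r₁ r₂ h₁ h₂ => simp only [map_add, tmul_add, h₁, h₂]
      | tmul v c' =>
        induction v with
        | zero => simp
        | add r₁ r₂ h₁ h₂ => simp only [map_add, tmul_add, add_tmul, h₁, h₂]
        | tmul a' x' =>
          simp only [smashShape_tmul, one_mul, tensorMul_tmul, crossedMul_right_right hact halg,
            LinearMap.rTensor_tmul, LinearMap.comp_apply, rTensor_comulLast_comulLast,
            crossedMul_tmul]
          rw [comulLast_tmul]
          generalize comul₃ (K := K) x' = r
          induction comul (R := K) x with
          | zero => simp
          | add r₁ r₂ h₁ h₂ => simp only [map_add, tmul_add, add_tmul, h₁, h₂]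
          | tmul p q =>
            induction r with
            | zero => simp
            | add r₁ r₂ h₁ h₂ => simp only [map_add, tmul_add, add_tmul, h₁, h₂]
            | tmul w z =>
              induction w with
              | zero => simp
              | add r₁ r₂ h₁ h₂ => simp only [map_add, tmul_add, add_tmul, h₁, h₂]
              | tmul w y =>
                simp [twist_tmul, smashShape_tmul, Algebra.TensorProduct.tmul_mul_tmul]

variable [Coalgebra K B]

/-- Apply ρ to the first leg of `comul_mul` and expand with `coact_mul`. Comodule coassociativity
turns the extra coactions into coproducts of the H-legs, which are those of the crossed product. -/
theorem smashComul_right_right (hact : IsRightWeakAction act) (hρ : IsRightComodule ρ)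
    (halg : IsUnitalAssociative (crossedMul act τ) ((1 : H) ⊗ₜ[K] (1 : B)))
    (hc : Compatible act τ ρ) (b b' : B) :
    smashComul ρ (crossedMul act τ (1 ⊗ₜ b) (1 ⊗ₜ b')) =
      tensorMul (crossedMul act τ) (smashComul ρ (1 ⊗ₜ b)) (smashComul ρ (1 ⊗ₜ b')) := by
  have hl : ρ.rTensor H ∘ₗ ρ = comulLast K H B ∘ₗ ρ := by
    ext b
    exact (LinearEquiv.eq_symm_apply _).2 (hρ.coassoc b)
  have h₁ : (ρ.rTensor H).rTensor B (coactFst ρ b) =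
      (comulLast K H B).rTensor B (coactFst ρ b) := by
    simp only [coactFst, LinearMap.comp_apply]
    rw [← LinearMap.rTensor_comp_apply, hl, LinearMap.rTensor_comp_apply]
  have h₂ : ((ρ.rTensor H).rTensor H).rTensor B (coactFst₂ ρ b') =
      ((comulLast K H B).rTensor H ∘ₗ comulLast K H B).rTensor B (coactFst ρ b') := by
    have : (ρ.rTensor H).rTensor H ∘ₗ ρ.rTensor H ∘ₗ ρ =
        ((comulLast K H B).rTensor H ∘ₗ comulLast K H B) ∘ₗ ρ := by
      rw [← LinearMap.comp_assoc, ← LinearMap.rTensor_comp, hl, LinearMap.rTensor_comp,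
        LinearMap.comp_assoc, hl, LinearMap.comp_assoc]
    simp only [coactFst, coactFst₂, LinearMap.comp_apply (LinearMap.rTensor B _)]
    rw [← LinearMap.rTensor_comp_apply, this, LinearMap.rTensor_comp_apply]
  rw [crossedMul_right_right hact halg, smashComul_right, smashComul_right, smashComul_right,
    ← smashShape_twist hact halg, ← h₁, ← h₂, ← rTensor_twist hc.coact_mul, ← hc.comul_mul]
  rfl

end RightRight

/-! ### Identities in B ⊗ H moved to the two middle slots. -/

section Factors

variable {K H B : Type*} [Field K] [Ring H] [Bialgebra K H] [Ring B] [Algebra K B]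

variable (K H B) in
/-- `b ⊗ h ↦ (1 ⊗ b) ⊗ (h ⊗ 1)`. -/
noncomputable def inclMiddle : B ⊗[K] H →ₐ[K] (H ⊗[K] B) ⊗[K] (H ⊗[K] B) :=
  Algebra.TensorProduct.map Algebra.TensorProduct.includeRight Algebra.TensorProduct.includeLeft

theorem inclMiddle_tmul (b : B) (h : H) :
    inclMiddle K H B (b ⊗ₜ h) = (1 ⊗ₜ b) ⊗ₜ (h ⊗ₜ 1) := rfl

theorem inclMiddle_eq (t : B ⊗[K] H) :
    inclMiddle K H B t = LinearMap.mul' K _ (TensorProduct.map (incl₂ K H B).toLinearMap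
      (incl₃ K H B).toLinearMap t) := by
  induction t with
  | zero => simp
  | add r₁ r₂ h₁ h₂ => simp only [map_add, h₁, h₂]
  | tmul b h => simp [inclMiddle_tmul, incl₂_apply, incl₃_apply]

theorem includeLeft_tmul_eq (x : H) (b : B) :
    ((x ⊗ₜ b) ⊗ₜ 1 : (H ⊗[K] B) ⊗[K] (H ⊗[K] B)) = incl₁ K H B x * incl₂ K H B b := by
  simp [incl₁_apply, incl₂_apply, Algebra.TensorProduct.one_def]

theorem includeRight_tmul_eq (x : H) (b : B) :
    (1 ⊗ₜ (x ⊗ₜ b) : (H ⊗[K] B) ⊗[K] (H ⊗[K] B)) = incl₃ K H B x * incl₄ K H B b := by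
  simp [incl₃_apply, incl₄_apply, Algebra.TensorProduct.one_def]

end Factors

/-! ### Multiplicativity on (x ⊗ 1)(y ⊗ 1). -/

section LeftLeft

variable {K H B : Type*} [Field K] [Ring H] [Bialgebra K H] [Ring B] [Algebra K B]
variable {act : B →ₗ[K] H →ₗ[K] B} {τ : H →ₗ[K] H →ₗ[K] B} {ρ : B →ₗ[K] B ⊗[K] H}
variable {C : Type*} [Ring C] [Algebra K C]

variable (K H) in
/-- The coproduct of the coalgebra `H ⊗ H`. -/
noncomputable def comulPairHom : H ⊗[K] H →ₗ[K] (H ⊗[K] H) ⊗[K] (H ⊗[K] H) :=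
  (tensorTensorTensorComm K H H H H).toLinearMap ∘ₗ TensorProduct.map comul comul

theorem comulPairHom_tmul (x y : H) : comulPairHom K H (x ⊗ₜ y) = comulPair x y := rfl

theorem prodAlong_comulPair_assoc (f g k : H ⊗[K] H →ₗ[K] C) :
    prodAlong (comulPairHom K H) (prodAlong (comulPairHom K H) f g) k =
      prodAlong (comulPairHom K H) f (prodAlong (comulPairHom K H) g k) := by
  have : comulPairHom K H = comul (R := K) (A := H ⊗[K] H) := by
    refine TensorProduct.ext' fun x y => ?_
    rw [comulPairHom_tmul, TensorProduct.comul_tmul]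
    rfl
  rw [this, prodAlong_comul_assoc]

theorem comulLeft_comp_mul :
    comulLeft K H B ∘ₗ LinearMap.mul' K H =
      prodAlong (comulPairHom K H) ((incl₁ K H B).toLinearMap ∘ₗ LinearMap.mul' K H)
        ((incl₃ K H B).toLinearMap ∘ₗ LinearMap.mul' K H) := by
  refine TensorProduct.ext' fun x y => ?_
  simp only [comulLeft, LinearMap.comp_apply, prodAlong_apply, LinearMap.mul'_apply,
    Bialgebra.comul_mul, comulPairHom_tmul, comulPair]
  induction comul (R := K) x with
  | zero => simp
  | add r₁ r₂ h₁ h₂ => simp only [map_add, add_tmul, add_mul, h₁, h₂]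
  | tmul a b =>
    induction comul (R := K) y with
    | zero => simp
    | add r₁ r₂ h₁ h₂ => simp only [map_add, tmul_add, mul_add, h₁, h₂]
    | tmul c d => simp [Algebra.TensorProduct.tmul_mul_tmul]

variable [Coalgebra K B]

/-- By `comul_cocycle`, τ commutes with the coproducts of H ⊗ H and B. -/
theorem prodAlong_comul_comp_cocycle (hc : Compatible act τ ρ) (f g : B →ₗ[K] C) :
    prodAlong comul f g ∘ₗ TensorProduct.lift τ =
      prodAlong (comulPairHom K H) (f ∘ₗ TensorProduct.lift τ) (g ∘ₗ TensorProduct.lift τ) := by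
  refine TensorProduct.ext' fun x y => ?_
  simp only [LinearMap.comp_apply, prodAlong_apply, lift.tmul, hc.comul_cocycle,
    comulPairHom_tmul, TensorProduct.map_comp]

/-- The condition `coact_cocycle`, carried into slots two and three by the algebra map `inclMiddle`.
-/
theorem prodAlong_coact_cocycle (hc : Compatible act τ ρ) :
    prodAlong (comulPairHom K H) ((incl₃ K H B).toLinearMap ∘ₗ LinearMap.mul' K H)
        (prodAlong ρ (incl₂ K H B).toLinearMap (incl₃ K H B).toLinearMap ∘ₗ
          TensorProduct.lift τ) =
      prodAlong (comulPairHom K H) ((incl₂ K H B).toLinearMap ∘ₗ TensorProduct.lift τ)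
        ((incl₃ K H B).toLinearMap ∘ₗ LinearMap.mul' K H) := by
  refine TensorProduct.ext' fun x y => ?_
  have h := congrArg (inclMiddle K H B) (hc.coact_cocycle x y)
  simp only [prodAlong_apply, comulPairHom_tmul]
  refine Eq.trans ?_ (h.trans ?_)
  · induction comulPair (K := K) x y with
    | zero => simp
    | add r₁ r₂ h₁ h₂ => simp only [map_add, h₁, h₂]
    | tmul u v =>
      simp only [map_tmul, LinearMap.mul'_apply, LinearMap.comp_apply, map_mul, prodAlong_apply,
        inclMiddle_eq (ρ _)]
      rfl
  · rw [inclMiddle_eq, ← LinearMap.comp_apply (TensorProduct.map _ _), ← TensorProduct.map_comp]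

/-- Let u = x ⊗ y in the coalgebra H ⊗ H and m the product of H. The left side has m(u₁) in slot
one, then m(u₂) in slot three times the coaction of τ(u₃), then τ(u₄) in slot four. The middle block
is replaced by τ(u₂) in slot two and m(u₃) in slot three, which is the right side. -/
theorem smashComul_left_left (hact : IsRightWeakAction act) (hc : Compatible act τ ρ) (x y : H) :
    smashComul ρ (crossedMul act τ (x ⊗ₜ 1) (y ⊗ₜ 1)) =
      tensorMul (crossedMul act τ) (smashComul ρ (x ⊗ₜ 1)) (smashComul ρ (y ⊗ₜ 1)) := by
  have h₁ : ∀ t : (H ⊗[K] H) ⊗[K] (H ⊗[K] H),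
      smashComul ρ (TensorProduct.map (LinearMap.mul' K H) (TensorProduct.lift τ) t) =
        LinearMap.mul' K _ (TensorProduct.map (comulLeft K H B ∘ₗ LinearMap.mul' K H)
          (comulRight ρ ∘ₗ TensorProduct.lift τ) t) := by
    intro t
    induction t with
    | zero => simp
    | add r₁ r₂ h₁ h₂ => simp only [map_add, h₁, h₂]
    | tmul u v => simp only [map_tmul, smashComul_tmul, LinearMap.mul'_apply, LinearMap.comp_apply]
  have h₂ : ∀ s t : H ⊗[K] H,
      tensorMul (crossedMul act τ) (TensorProduct.map (inclLeft K H B) (inclLeft K H B) s)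
        (TensorProduct.map (inclLeft K H B) (inclLeft K H B) t) =
      LinearMap.mul' K _ (TensorProduct.map
        (prodAlong (comulPairHom K H) ((incl₁ K H B).toLinearMap ∘ₗ LinearMap.mul' K H)
          ((incl₂ K H B).toLinearMap ∘ₗ TensorProduct.lift τ))
        (prodAlong (comulPairHom K H) ((incl₃ K H B).toLinearMap ∘ₗ LinearMap.mul' K H)
          ((incl₄ K H B).toLinearMap ∘ₗ TensorProduct.lift τ))
        (tensorTensorTensorComm K H H H H (s ⊗ₜ t))) := by
    intro s t
    induction s with
    | zero => simp
    | add r₁ r₂ h₁ h₂ => simp only [map_add, LinearMap.add_apply, add_tmul, h₁, h₂]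
    | tmul a b =>
      induction t with
      | zero => simp
      | add r₁ r₂ h₁ h₂ => simp only [map_add, tmul_add, h₁, h₂]
      | tmul c d =>
        simp only [map_tmul, inclLeft_apply, tensorMul_tmul, crossedMul_left_left hact,
          tensorTensorTensorComm_tmul, LinearMap.mul'_apply, prodAlong_apply, comulPairHom_tmul]
        generalize comulPair (K := K) b d = v
        induction comulPair (K := K) a c with
        | zero => simp
        | add r₁ r₂ h₁ h₂ => simp only [map_add, add_tmul, add_mul, h₁, h₂]
        | tmul p q =>
          induction v with
          | zero => simp
          | add r₁ r₂ h₁ h₂ => simp only [map_add, tmul_add, mul_add, h₁, h₂]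
          | tmul r s =>
            simp only [map_tmul, LinearMap.mul'_apply, LinearMap.comp_apply,
              AlgHom.toLinearMap_apply, ← includeLeft_tmul_eq, ← includeRight_tmul_eq,
              Algebra.TensorProduct.tmul_mul_tmul, one_mul, mul_one]
  rw [smashComul_left hc.comul_one hc.coact_one, smashComul_left hc.comul_one hc.coact_one,
    crossedMul_left_left hact, h₁, h₂]
  change prodAlong (comulPairHom K H) _ _ (x ⊗ₜ y) = prodAlong (comulPairHom K H) _ _ (x ⊗ₜ y)
  rw [comulLeft_comp_mul, comulRight, prodAlong_comul_comp_cocycle hc, prodAlong_comulPair_assoc,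
    ← prodAlong_comulPair_assoc _ _ ((incl₄ K H B).toLinearMap ∘ₗ _), prodAlong_coact_cocycle hc]
  simp only [prodAlong_comulPair_assoc]

end LeftLeft

/-! ### Multiplicativity on (1 ⊗ b)(x ⊗ 1), by convolution in x. -/

section RightLeft

open WithConv

variable {K H B : Type*} [Field K] [Ring H] [Bialgebra K H] [Ring B] [Algebra K B]
variable {act : B →ₗ[K] H →ₗ[K] B} {τ : H →ₗ[K] H →ₗ[K] B} {ρ : B →ₗ[K] B ⊗[K] H}
variable {C : Type*} [Ring C] [Algebra K C]

/-- `m ↦ f ∘ g(m)`, as a map into the convolution algebra of linear maps `H → C`. -/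
noncomputable def convComp {M N : Type*} [AddCommGroup M] [Module K M] [AddCommGroup N]
    [Module K N] (g : M →ₗ[K] H →ₗ[K] N) (f : N →ₗ[K] C) : M →ₗ[K] WithConv (H →ₗ[K] C) :=
  (WithConv.linearEquiv K (H →ₗ[K] C)).symm.toLinearMap ∘ₗ g.compr₂ f

theorem convComp_apply {M N : Type*} [AddCommGroup M] [Module K M] [AddCommGroup N]
    [Module K N] (g : M →ₗ[K] H →ₗ[K] N) (f : N →ₗ[K] C) (m : M) :
    convComp g f m = toConv (f ∘ₗ g m) := rfl

theorem convMul_convMul_apply (f g k : WithConv (H →ₗ[K] C)) (x : H) :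
    (f * g * k) x = LinearMap.mul' K C (TensorProduct.map
      (LinearMap.mul' K C ∘ₗ TensorProduct.map f.ofConv g.ofConv) k.ofConv
        (comul₃ (K := K) x)) := by
  simp only [LinearMap.convMul_apply, comul₃, LinearMap.comp_apply]
  induction comul (R := K) x with
  | zero => simp
  | add r₁ r₂ h₁ h₂ => simp only [map_add, h₁, h₂]
  | tmul y z => simp [LinearMap.convMul_def]

theorem toConv_prodAlong_mul (f g : H →ₗ[K] C) (k : WithConv (H →ₗ[K] C)) :
    toConv (prodAlong comul f g) * k = toConv f * (toConv g * k) :=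
  mul_assoc (toConv f) (toConv g) k

/-- As a function of z, the product h₁z₁ ⊗ τ(h₂, z₂)(c ◁ z₃) is a triple convolution, so the legs of
z need no further bookkeeping. -/
theorem includeRight_crossedMul_left (h z : H) (c : B) :
    (1 ⊗ₜ crossedMul act τ (h ⊗ₜ c) (z ⊗ₜ 1) : (H ⊗[K] B) ⊗[K] (H ⊗[K] B)) =
      (prodAlong comul (convComp (LinearMap.mul K H) (incl₃ K H B).toLinearMap)
        (convComp τ (incl₄ K H B).toLinearMap) h * convComp act (incl₄ K H B).toLinearMap c :
        WithConv (H →ₗ[K] (H ⊗[K] B) ⊗[K] (H ⊗[K] B))) z := by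
  rw [crossedMul_tmul, prodAlong_apply]
  induction comul (R := K) h with
  | zero => simp
  | add r₁ r₂ h₁ h₂ =>
    simp only [map_add, add_tmul, tmul_add, add_mul, h₁, h₂, ofConv_add, LinearMap.add_apply]
  | tmul p q =>
    simp only [map_tmul, LinearMap.mul'_apply, convMul_convMul_apply, convComp_apply]
    induction comul₃ (K := K) z with
    | zero => simp
    | add r₁ r₂ h₁ h₂ => simp only [map_add, add_tmul, tmul_add, h₁, h₂]
    | tmul u w =>
      induction u with
      | zero => simp
      | add r₁ r₂ h₁ h₂ => simp only [map_add, add_tmul, tmul_add, h₁, h₂]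
      | tmul u v => simp [twist_tmul, includeRight_tmul_eq, mul_assoc]

theorem includeLeft_crossedMul_right (hact : IsRightWeakAction act)
    (halg : IsUnitalAssociative (crossedMul act τ) ((1 : H) ⊗ₜ[K] (1 : B))) (b : B) (y : H) :
    (crossedMul act τ (1 ⊗ₜ b) (y ⊗ₜ 1) ⊗ₜ 1 : (H ⊗[K] B) ⊗[K] (H ⊗[K] B)) =
      (toConv (incl₁ K H B).toLinearMap * convComp act (incl₂ K H B).toLinearMap b :
        WithConv (H →ₗ[K] (H ⊗[K] B) ⊗[K] (H ⊗[K] B))) y := by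
  rw [crossedMul_right_left hact halg, LinearMap.convMul_apply]
  induction comul (R := K) y with
  | zero => simp
  | add r₁ r₂ h₁ h₂ => simp only [map_add, add_tmul, h₁, h₂]
  | tmul u v => simp [includeLeft_tmul_eq, convComp_apply]

theorem tensorMul_smashShape_left (hact : IsRightWeakAction act)
    (halg : IsUnitalAssociative (crossedMul act τ) ((1 : H) ⊗ₜ[K] (1 : B)))
    (s : (B ⊗[K] H) ⊗[K] B) (x : H) :
    tensorMul (crossedMul act τ) (smashShape ((1 ⊗ₜ 1) ⊗ₜ s))
        (TensorProduct.map (inclLeft K H B) (inclLeft K H B) (comul (R := K) x)) =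
      (toConv (incl₁ K H B).toLinearMap * LinearMap.mul' K _ (TensorProduct.map
        (LinearMap.mul' K _ ∘ₗ TensorProduct.map (convComp act (incl₂ K H B).toLinearMap)
          (prodAlong comul (convComp (LinearMap.mul K H) (incl₃ K H B).toLinearMap)
            (convComp τ (incl₄ K H B).toLinearMap)))
        (convComp act (incl₄ K H B).toLinearMap) s) :
        WithConv (H →ₗ[K] (H ⊗[K] B) ⊗[K] (H ⊗[K] B))) x := by
  induction s with
  | zero => simp
  | add r₁ r₂ h₁ h₂ =>
    simp only [map_add, LinearMap.add_apply, tmul_add, mul_add, ofConv_add, h₁, h₂]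
  | tmul u c =>
    induction u with
    | zero => simp
    | add r₁ r₂ h₁ h₂ =>
      simp only [map_add, LinearMap.add_apply, tmul_add, add_tmul, mul_add, ofConv_add, h₁, h₂]
    | tmul b h =>
      simp only [map_tmul, LinearMap.mul'_apply, LinearMap.comp_apply]
      rw [mul_assoc, ← mul_assoc, LinearMap.convMul_apply]
      induction comul (R := K) x with
      | zero => simp
      | add r₁ r₂ h₁ h₂ => simp only [map_add, h₁, h₂]
      | tmul y z =>
        rw [map_tmul, map_tmul, LinearMap.mul'_apply, ← includeLeft_crossedMul_right hact halg,
          ← includeRight_crossedMul_left, Algebra.TensorProduct.tmul_mul_tmul, one_mul, mul_one,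
          smashShape_tmul, one_mul, tensorMul_tmul, inclLeft_apply, inclLeft_apply]

variable [Coalgebra K B]

/-- The condition `comul_act` in the convolution algebra; g is an algebra map so that it splits the
product τ(b_1[1], x₂)(b_2 ◁ x₃). -/
theorem toConv_prodAlong_comp_act (hc : Compatible act τ ρ) (f : B →ₗ[K] C) (g : B →ₐ[K] C)
    (b : B) :
    toConv (prodAlong comul f g.toLinearMap ∘ₗ act b) =
      prodAlong comul (prodAlong ρ (convComp act f) (convComp τ g.toLinearMap))
        (convComp act g.toLinearMap) b := by
  rw [prodAlong_prodAlong_coact]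
  ext x
  change LinearMap.mul' K C (TensorProduct.map f g.toLinearMap (comul (act b x))) = _
  rw [hc.comul_act]
  induction coactFst ρ b with
  | zero => simp
  | add r₁ r₂ h₁ h₂ => simp only [map_add, add_tmul, h₁, h₂, ofConv_add, LinearMap.add_apply]
  | tmul u c =>
    induction u with
    | zero => simp
    | add r₁ r₂ h₁ h₂ => simp only [map_add, add_tmul, h₁, h₂, ofConv_add, LinearMap.add_apply]
    | tmul a h =>
      simp only [map_tmul, LinearMap.mul'_apply, LinearMap.comp_apply, convMul_convMul_apply,
        convComp_apply]
      induction comul₃ (K := K) x with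
      | zero => simp
      | add r₁ r₂ h₁ h₂ => simp only [map_add, tmul_add, h₁, h₂]
      | tmul v z =>
        induction v with
        | zero => simp
        | add r₁ r₂ h₁ h₂ => simp only [map_add, tmul_add, add_tmul, h₁, h₂]
        | tmul v y => simp [actShape_tmul, mul_assoc]

/-- The condition `coact_act`, carried into slots two and three and read as an identity of
convolution products. -/
theorem toConv_incl_mul_coact_act (hc : Compatible act τ ρ) :
    LinearMap.mulLeft K (toConv (incl₃ K H B).toLinearMap) ∘ₗ
        convComp act (prodAlong ρ (incl₂ K H B).toLinearMap (incl₃ K H B).toLinearMap) =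
      prodAlong ρ (convComp act (incl₂ K H B).toLinearMap)
        (convComp (LinearMap.mul K H) (incl₃ K H B).toLinearMap) := by
  ext b x
  have h := congrArg (inclMiddle K H B) (hc.coact_act b x)
  refine Eq.trans ?_ (h.trans ?_)
  · simp only [LinearMap.comp_apply, LinearMap.mulLeft_apply, LinearMap.convMul_apply,
      convComp_apply]
    induction comul (R := K) x with
    | zero => simp
    | add r₁ r₂ h₁ h₂ => simp only [map_add, h₁, h₂]
    | tmul u v =>
      simp only [map_tmul, LinearMap.mul'_apply, LinearMap.comp_apply, map_mul, prodAlong_apply,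
        inclMiddle_eq (ρ _)]
      rfl
  · rw [prodAlong_apply]
    induction ρ b with
    | zero => simp
    | add r₁ r₂ h₁ h₂ => simp only [map_add, add_tmul, h₁, h₂, ofConv_add, LinearMap.add_apply]
    | tmul c h =>
      simp only [map_tmul, LinearMap.mul'_apply, LinearMap.convMul_apply, convComp_apply]
      induction comul (R := K) x with
      | zero => simp
      | add r₁ r₂ h₁ h₂ => simp only [map_add, tmul_add, h₁, h₂]
      | tmul y z => simp [inclMiddle_tmul, incl₂_apply, incl₃_apply]

/-- In Δ(1 ⊗ b)Δ(x ⊗ 1), comodule coassociativity isolates a block b_[0] ◁ x₁, b_[1] x₂, which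
`coact_act` replaces by a third-slot factor times the coaction of b ◁ x. That factor moves to the
far left to form the coproduct of H, and `comul_act` reassembles the rest. -/
theorem smashComul_right_left (hact : IsRightWeakAction act) (hρ : IsRightComodule ρ)
    (halg : IsUnitalAssociative (crossedMul act τ) ((1 : H) ⊗ₜ[K] (1 : B)))
    (hc : Compatible act τ ρ) (b : B) (x : H) :
    smashComul ρ (crossedMul act τ (1 ⊗ₜ b) (x ⊗ₜ 1)) =
      tensorMul (crossedMul act τ) (smashComul ρ (1 ⊗ₜ b)) (smashComul ρ (x ⊗ₜ 1)) := by
  have h₁ : smashComul ρ ((act b).lTensor H (comul (R := K) x)) =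
      (toConv (comulLeft K H B) * toConv (comulRight ρ ∘ₗ act b)) x := by
    rw [LinearMap.convMul_apply]
    induction comul (R := K) x with
    | zero => simp
    | add r₁ r₂ h₁ h₂ => simp only [map_add, h₁, h₂]
    | tmul u v => simp [smashComul_tmul]
  rw [crossedMul_right_left hact halg, h₁, smashComul_left hc.comul_one hc.coact_one,
    smashComul_right, tensorMul_smashShape_left hact halg, ← prodAlong_prodAlong_coact,
    ← prodAlong_coact_assoc hρ, ← toConv_incl_mul_coact_act hc, ← mulLeft_comp_prodAlong,
    ← mulLeft_comp_prodAlong]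
  exact congrArg
    (fun f : WithConv (H →ₗ[K] (H ⊗[K] B) ⊗[K] (H ⊗[K] B)) => f.ofConv x)
    ((toConv_prodAlong_mul _ _ _).trans (congrArg _ (congrArg _ (toConv_prodAlong_comp_act hc _ _ b))))

end RightLeft

/-! ### From the compatibility conditions to a bialgebra. -/

section Sufficiency

variable {K H B : Type*} [Field K] [Ring H] [Bialgebra K H] [Ring B] [Algebra K B]
  [Coalgebra K B]
variable {act : B →ₗ[K] H →ₗ[K] B} {τ : H →ₗ[K] H →ₗ[K] B} {ρ : B →ₗ[K] B ⊗[K] H}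

theorem smashCounit_crossedMul
    (hτ : ∀ x x' : H, counit (R := K) (τ x x') = counit (R := K) x * counit (R := K) x')
    (hc : Compatible act τ ρ) (v w : H ⊗[K] B) :
    smashCounit (K := K) (crossedMul act τ v w) =
      smashCounit (K := K) v * smashCounit (K := K) w := by
  induction v with
  | zero => simp
  | add r₁ r₂ h₁ h₂ => simp only [map_add, LinearMap.add_apply, add_mul, h₁, h₂]
  | tmul y b =>
    induction w with
    | zero => simp
    | add r₁ r₂ h₁ h₂ => simp only [map_add, mul_add, h₁, h₂]
    | tmul x c =>
      have h : ∀ t : H ⊗[K] H,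
          counit (R := K) (LinearMap.mul' K B (TensorProduct.map (τ y) (act b) t)) =
            counit (R := K) y * counit (R := K) b *
              counit (R := K) (TensorProduct.rid K H ((counit (R := K)).lTensor H t)) := by
        intro t
        induction t with
        | zero => simp
        | add r₁ r₂ h₁ h₂ => simp only [map_add, mul_add, h₁, h₂]
        | tmul p q =>
          simp only [map_tmul, LinearMap.mul'_apply, hc.counit_mul, hτ, hc.counit_act,
            LinearMap.lTensor_tmul, rid_tmul, map_smul, smul_eq_mul]
          ring
      rw [← counit_projRight, projRight_crossedMul, hc.counit_mul, h, smashCounit_tmul,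
        smashCounit_tmul, lTensor_counit_comul]
      simp only [rid_tmul, one_smul]
      ring

theorem smashComul_crossedMul (hact : IsRightWeakAction act) (hρ : IsRightComodule ρ)
    (halg : IsUnitalAssociative (crossedMul act τ) ((1 : H) ⊗ₜ[K] (1 : B)))
    (hc : Compatible act τ ρ) (v w : H ⊗[K] B) :
    smashComul ρ (crossedMul act τ v w) =
      tensorMul (crossedMul act τ) (smashComul ρ v) (smashComul ρ w) := by
  have split : ∀ (x : H) (b : B), x ⊗ₜ[K] b = crossedMul act τ (x ⊗ₜ 1) (1 ⊗ₜ b) :=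
    fun x b => (crossedMul_left_right hact halg x b).symm
  have comul_split : ∀ (x : H) (b : B), smashComul ρ (x ⊗ₜ b) =
      tensorMul (crossedMul act τ) (smashComul ρ (x ⊗ₜ 1)) (smashComul ρ (1 ⊗ₜ b)) :=
    fun x b => (smashComul_tmul_eq_tensorMul_iff hact halg hc.comul_one hc.coact_one b).2
      (hc.twisted_cocycle b) x
  -- Multiplicativity is extended by associativity: first to right factors 1 ⊗ c, then to left
  -- factors x ⊗ 1 using this, then to right factors x ⊗ 1 using that. A general right factor is a
  -- product of the two kinds.
  have mul_right : ∀ (u : H ⊗[K] B) (c : B), smashComul ρ (crossedMul act τ u (1 ⊗ₜ c)) =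
      tensorMul (crossedMul act τ) (smashComul ρ u) (smashComul ρ (1 ⊗ₜ c)) := by
    intro u c
    induction u with
    | zero => simp
    | add r₁ r₂ h₁ h₂ => simp only [map_add, LinearMap.add_apply, h₁, h₂]
    | tmul x b =>
      rw [comul_split x b, tensorMul_assoc halg, ← smashComul_right_right hact hρ halg hc,
        split x b, halg.assoc, crossedMul_right_right hact halg, ← split, ← comul_split]
  have left_mul : ∀ (x : H) (u : H ⊗[K] B), smashComul ρ (crossedMul act τ (x ⊗ₜ 1) u) =
      tensorMul (crossedMul act τ) (smashComul ρ (x ⊗ₜ 1)) (smashComul ρ u) := by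
    intro x u
    induction u with
    | zero => simp
    | add r₁ r₂ h₁ h₂ => simp only [map_add, h₁, h₂]
    | tmul y c =>
      rw [comul_split y c, ← tensorMul_assoc halg, ← smashComul_left_left hact hc,
        split y c, ← halg.assoc, mul_right]
  have mul_left : ∀ (u : H ⊗[K] B) (x : H), smashComul ρ (crossedMul act τ u (x ⊗ₜ 1)) =
      tensorMul (crossedMul act τ) (smashComul ρ u) (smashComul ρ (x ⊗ₜ 1)) := by
    intro u x
    induction u with
    | zero => simp
    | add r₁ r₂ h₁ h₂ => simp only [map_add, LinearMap.add_apply, h₁, h₂]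
    | tmul y b =>
      rw [comul_split y b, tensorMul_assoc halg, ← smashComul_right_left hact hρ halg hc,
        split y b, halg.assoc, left_mul]
  induction w with
  | zero => simp
  | add r₁ r₂ h₁ h₂ => simp only [map_add, h₁, h₂]
  | tmul x c =>
    rw [comul_split x c, ← tensorMul_assoc halg, ← mul_left, ← mul_right, halg.assoc, ← split]

theorem Compatible.isBialgebraWith (hact : IsRightWeakAction act)
    (hρ : IsRightComoduleCoalgebra ρ)
    (hτ : ∀ x x' : H, counit (R := K) (τ x x') = counit (R := K) x * counit (R := K) x')
    (halg : IsUnitalAssociative (crossedMul act τ) ((1 : H) ⊗ₜ[K] (1 : B)))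
    (hc : Compatible act τ ρ) :
    IsBialgebraWith (crossedMul act τ) ((1 : H) ⊗ₜ[K] (1 : B)) (smashComul ρ) smashCounit := by
  refine isBialgebraWith_of halg (smashComul_coassoc hρ) (rTensor_smashCounit hρ)
    (lTensor_smashCounit hρ) (smashComul_crossedMul hact hρ.toIsRightComodule halg hc) ?_
    (smashCounit_crossedMul hτ hc) ?_
  · rw [smashComul_left hc.comul_one hc.coact_one, Bialgebra.comul_one,
      Algebra.TensorProduct.one_def, map_tmul, inclLeft_apply]
  · simp [smashCounit_tmul, hc.counit_one]

end Sufficiency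

end CrossedBiproduct

theorem corollary3p10 {K H B : Type*} [Field K] [Ring H] [Bialgebra K H]
    [Ring B] [Algebra K B] [Coalgebra K B]
    (act : B →ₗ[K] H →ₗ[K] B) (hact : CrossedBiproduct.IsRightWeakAction act)
    (ρ : B →ₗ[K] B ⊗[K] H) (hρ : CrossedBiproduct.IsRightComoduleCoalgebra ρ)
    (τ : H →ₗ[K] H →ₗ[K] B)
    (hτ : ∀ x x' : H, Coalgebra.counit (R := K) (τ x x') =
      Coalgebra.counit (R := K) x * Coalgebra.counit (R := K) x')
    (halg : CrossedBiproduct.IsUnitalAssociative (CrossedBiproduct.crossedMul act τ)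
      ((1 : H) ⊗ₜ[K] (1 : B))) :
    CrossedBiproduct.IsBialgebraWith (CrossedBiproduct.crossedMul act τ)
        ((1 : H) ⊗ₜ[K] (1 : B)) (CrossedBiproduct.smashComul ρ) CrossedBiproduct.smashCounit ↔
      CrossedBiproduct.Compatible act τ ρ :=
  ⟨fun h => h.compatible hact hρ hτ halg, fun h => h.isBialgebraWith hact hρ hτ halg⟩
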